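/- By a graph $G$ on $[0,n]=\{0,1,\dots,n\}$ we mean a loopless multigraph whose edges are directed from smaller to larger vertices; $E(G)$ is its multiset of edges and $\mathrm{indeg}_G(i)$ the number of edges directed into $i$. If $G$ has edges $(i,j)$ and $(j,k)$ with $i<j<k$, a reduction on them produces the three graphs with edge multisets $E(G)\setminus\{(j,k)\}\cup\{(i,k)\}$, $E(G)\setminus\{(i,j)\}\cup\{(i,k)\}$ and $E(G)\setminus\{(i,j),(j,k)\}\cup\{(i,k)\}$. A reduction tree of $G$ is a tree with root labelled $G$ in which every inner node has three children, labelled by the results of one reduction of its label, and in which the labels of the leaves cannot be reduced. $\mathrm{LD}(G)$ is the multiset of the left-degree sequences $(\mathrm{indeg}_L(1),\dots,\mathrm{indeg}_L(n))$ of the leaves $L$ of a reduction tree of $G$, and $$L_G(\mathbf t)=\sum_{\alpha\in \mathrm{LD}(G)}(-1)^{\#E(G)-\sum_i\alpha_i}\,\mathbf t^{\alpha},\qquad \mathbf t=(t_1,\dots,t_n).$$ For $k\ge 0$ let $L_G^k$ be the homogeneous component of $L_G$ of degree $\#E(G)-k$ (zero if this degree is negative). The Newton polytope $\mathrm{Newton}(f)\subseteq\mathbb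 R^n$ is the convex hull of the exponents of the monomials of $f$ with nonzero coefficient, and $f$ has polytopal support if every integer point of $\mathrm{Newton}(f)$ is the exponent of a monomial of $f$ with nonzero coefficient. Let $G\setminus 0$ be $G$ with the vertex $0$ deleted. Let $G^{\mathrm{aug}}$ be the graph on $\{1,\dots,n\}\cup\{t\}$ with edges $a_j:j\to t$ for $j\in[n]$ and, for every $e=(j,i)\in E(G\setminus 0)$ (with multiplicity), edges $z_e:j\to i$ and $y_e:j\to t$; let $\mathcal F^c_{G^{\mathrm{aug}}}$ be the polytope of nonnegative real flows on $G^{\mathrm{aug}}$ with values at most $1$ on the edges $y_e$ and with netflow (outflow minus inflow) $\mathrm{indeg}_G(j)$ at $j\in[n]$ and $-\#E(G)$ at $t$. Let $G^{(k)}$ be the graph on $\{1,\dots,n+1\}\cup\{t\}$ with the same edges, except that $y_e$ goes from $j$ to $n+1$; let $\mathcal F^c_{G^{(k)}}$ be the polytope of nonnegative real flows on $G^{(k)}$ with values at most $1$ on the edges $y_e$ and with netflow $\mathrm{indeg}_G(j)$ at $j\in[n]$, $-k$ at $n+1$ and $k-\#E(G)$ at $t$. Let $\psi$ map a flow to its values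 on $(a_1,\dots,a_n)$, and for $I\subseteq[n]$ put $z_I^{(k)}=\min\{\sum_{i\in I}f(a_i): f\in\mathcal F^c_{G^{(k)}}\}$. **Theorem B.** Let $G$ be a graph on $[0,n]$. 1. $\mathrm{LD}(G)$, and so $L_G$, does not depend on the choice of the reduction tree. 2. $\mathrm{Newton}(L_G)=\psi(\mathcal F^c_{G^{\mathrm{aug}}})$, the integer points of this polytope are exactly the elements of $\mathrm{LD}(G)$, and $L_G$ has polytopal support. 3. For every $k\ge0$, $\mathrm{Newton}(L_G^k)=\psi(\mathcal F^c_{G^{(k)}})$, the integer points of this polytope are exactly the elements of $\mathrm{LD}(G)$ with coordinate sum $\#E(G)-k$, and $L_G^k$ has polytopal support. If $L_G^k\neq0$, then the minima $z_I^{(k)}$ exist, satisfy $z_\emptyset^{(k)}=0$ and $z^{(k)}_{I\cup J}+z^{(k)}_{I\cap J}\ge z^{(k)}_I+z^{(k)}_J$ for all $I,J\subseteq[n]$, and $\mathrm{Newton}(L_G^k)$ is the generalized permutahedron $$P_n^z\{z_I^{(k)}\}=\Big\{\mathbf t\in\mathbb R^n:\ \sum_{i\in I}t_i\ge z_I^{(k)}\text{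 for } I\subsetneq[n],\ \ \sum_{i=1}^n t_i=z_{[n]}^{(k)}\Big\}.$$ 4. If $G$ is acyclic (as an undirected multigraph), then $L_G^0$ is the integer-point transform of its Newton polytope: $L_G^0(\mathbf t)=\sum_{p\in \mathrm{Newton}(L_G^0)\cap\mathbb Z^n}\mathbf t^{p}$. -/

import Mathlib

noncomputable section

open scoped BigOperators

namespace LeftDegree

/-! Graphs on the vertex set `{0, …, n}`, reduction trees, and left-degree sequences. -/

/-- A loopless multigraph on `{0, …, n}` whose edges are directed from the smaller to the larger
vertex. The edges form a multiset, so multiple edges are allowed. -/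
structure Graph (n : ℕ) where
  /-- the multiset of edges -/
  edges : Multiset (Fin (n + 1) × Fin (n + 1))
  /-- every edge goes from a smaller to a larger vertex -/
  increasing : ∀ e ∈ edges, e.1 < e.2

namespace Graph

variable {n : ℕ}

/-- The number of edges, counted with multiplicity. -/
def numEdges (G : Graph n) : ℕ := Multiset.card G.edges

/-- The number of edges directed into the vertex `v`. -/
def indeg (G : Graph n) (v : Fin (n + 1)) : ℕ := G.edges.countP (fun e => e.2 = v)

/-- The sequence `(indeg 1, …, indeg n)`; the index `i : Fin n` stands for the vertex `i + 1`. -/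
def leftDegreeSeq (G : Graph n) : Fin n → ℕ := fun i => G.indeg i.succ

/-- First reduction on the edges `(i,j)`, `(j,k)`: one copy of `(j,k)` is replaced by `(i,k)`. -/
def reduce₁ (G : Graph n) (i j k : Fin (n + 1)) (hij : (i, j) ∈ G.edges)
    (hjk : (j, k) ∈ G.edges) : Graph n where
  edges := (i, k) ::ₘ G.edges.erase (j, k)
  increasing := by
    intro e he
    rcases Multiset.mem_cons.1 he with rfl | he
    · exact lt_trans (G.increasing (i, j) hij) (G.increasing (j, k) hjk)
    · exact G.increasing _ (Multiset.mem_of_mem_erase he)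

/-- Second reduction on the edges `(i,j)`, `(j,k)`: one copy of `(i,j)` is replaced by `(i,k)`. -/
def reduce₂ (G : Graph n) (i j k : Fin (n + 1)) (hij : (i, j) ∈ G.edges)
    (hjk : (j, k) ∈ G.edges) : Graph n where
  edges := (i, k) ::ₘ G.edges.erase (i, j)
  increasing := by
    intro e he
    rcases Multiset.mem_cons.1 he with rfl | he
    · exact lt_trans (G.increasing (i, j) hij) (G.increasing (j, k) hjk)
    · exact G.increasing _ (Multiset.mem_of_mem_erase he)

/-- Third reduction on the edges `(i,j)`, `(j,k)`: one copy of each of them is deleted, and one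
edge `(i,k)` is added. -/
def reduce₃ (G : Graph n) (i j k : Fin (n + 1)) (hij : (i, j) ∈ G.edges)
    (hjk : (j, k) ∈ G.edges) : Graph n where
  edges := (i, k) ::ₘ (G.edges.erase (i, j)).erase (j, k)
  increasing := by
    intro e he
    rcases Multiset.mem_cons.1 he with rfl | he
    · exact lt_trans (G.increasing (i, j) hij) (G.increasing (j, k) hjk)
    · exact G.increasing _ (Multiset.mem_of_mem_erase (Multiset.mem_of_mem_erase he))

/-- No reduction can be performed on `G`. -/
def Irreducible (G : Graph n) : Prop :=
  ∀ i j k : Fin (n + 1), (i, j) ∈ G.edges → (j, k) ∉ G.edges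

end Graph

/-- Reduction trees with root label `G`: a leaf carries a graph that cannot be reduced, and an
inner node has three children, labelled by the results of one reduction. -/
inductive ReductionTree {n : ℕ} : Graph n → Type
  | leaf (G : Graph n) (h : G.Irreducible) : ReductionTree G
  | node (G : Graph n) (i j k : Fin (n + 1)) (hij : (i, j) ∈ G.edges) (hjk : (j, k) ∈ G.edges)
      (T₁ : ReductionTree (G.reduce₁ i j k hij hjk))
      (T₂ : ReductionTree (G.reduce₂ i j k hij hjk))
      (T₃ : ReductionTree (G.reduce₃ i j k hij hjk)) : ReductionTree G

/-- The multiset of left-degree sequences of the leaves of a reduction tree. -/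
def ReductionTree.leftDegreeSeqs {n : ℕ} : {G : Graph n} → ReductionTree G → Multiset (Fin n → ℕ)
  | _, .leaf G _ => {G.leftDegreeSeq}
  | _, .node _ _ _ _ _ _ T₁ T₂ T₃ => T₁.leftDegreeSeqs + T₂.leftDegreeSeqs + T₃.leftDegreeSeqs

/-- A quantity that drops in every reduction. -/
def Graph.potential {n : ℕ} (G : Graph n) : ℕ :=
  (G.edges.map (fun e => n + 1 + (e.1 : ℕ) - (e.2 : ℕ))).sum

theorem Graph.exists_reductionTree {n : ℕ} :
    ∀ (N : ℕ) (G : Graph n), G.potential < N → Nonempty (ReductionTree G) := by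
  intro N
  induction N with
  | zero => intro G hG; exact absurd hG (Nat.not_lt_zero _)
  | succ N ih =>
    intro G hG
    by_cases h : G.Irreducible
    · exact ⟨.leaf G h⟩
    · simp only [Graph.Irreducible, not_forall, not_not] at h
      obtain ⟨i, j, k, hij, hjk⟩ := h
      have h1 : (i : ℕ) < j := G.increasing _ hij
      have h2 : (j : ℕ) < k := G.increasing _ hjk
      have h3 : (k : ℕ) < n + 1 := k.2
      have e1 := Multiset.sum_map_erase
        (f := fun e : Fin (n + 1) × Fin (n + 1) => n + 1 + (e.1 : ℕ) - (e.2 : ℕ)) hjk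
      have e2 := Multiset.sum_map_erase
        (f := fun e : Fin (n + 1) × Fin (n + 1) => n + 1 + (e.1 : ℕ) - (e.2 : ℕ)) hij
      have hne : (j, k) ≠ (i, j) := by
        intro hc
        have h4 : (j : ℕ) = i := congrArg (fun p : Fin (n + 1) × Fin (n + 1) => (p.1 : ℕ)) hc
        omega
      have e3 := Multiset.sum_map_erase
        (f := fun e : Fin (n + 1) × Fin (n + 1) => n + 1 + (e.1 : ℕ) - (e.2 : ℕ))
        ((Multiset.mem_erase_of_ne hne).2 hjk)
      simp only [Graph.potential] at hG e1 e2 e3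
      obtain ⟨T₁⟩ := ih (G.reduce₁ i j k hij hjk) (by
        simp only [Graph.potential, Graph.reduce₁, Multiset.map_cons, Multiset.sum_cons]; omega)
      obtain ⟨T₂⟩ := ih (G.reduce₂ i j k hij hjk) (by
        simp only [Graph.potential, Graph.reduce₂, Multiset.map_cons, Multiset.sum_cons]; omega)
      obtain ⟨T₃⟩ := ih (G.reduce₃ i j k hij hjk) (by
        simp only [Graph.potential, Graph.reduce₃, Multiset.map_cons, Multiset.sum_cons]; omega)
      exact ⟨.node G i j k hij hjk T₁ T₂ T₃⟩

/-- Every graph has a reduction tree. -/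
instance {n : ℕ} (G : Graph n) : Nonempty (ReductionTree G) :=
  Graph.exists_reductionTree (G.potential + 1) G (Nat.lt_succ_self _)

namespace Graph

variable {n : ℕ}

/-- The multiset `LD(G)` of left-degree sequences of the leaves of a reduction tree of `G`. -/
def LD (G : Graph n) : Multiset (Fin n → ℕ) :=
  (Classical.arbitrary (ReductionTree G)).leftDegreeSeqs

/-- The left-degree polynomial: the sum of `(-1) ^ codim α * t ^ α` over `LD(G)`, where
`codim α` is `#E(G)` minus the sum of the entries of `α` (never negative for `α` in `LD(G)`). -/
def leftDegreePolynomial (G : Graph n) : MvPolynomial (Fin n) ℤ :=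
  (G.LD.map (fun α => (-1) ^ (G.numEdges - ∑ i, α i) * ∏ i, MvPolynomial.X i ^ α i)).sum

/-- The homogeneous component of degree `#E(G) - k` of the left-degree polynomial; it is zero if
this degree is negative. -/
def leftDegreeComponent (G : Graph n) (k : ℕ) : MvPolynomial (Fin n) ℤ :=
  if k ≤ G.numEdges then
    MvPolynomial.homogeneousComponent (G.numEdges - k) G.leftDegreePolynomial
  else 0

/-- `G` has no cycle when the directions of its edges are forgotten; two parallel edges count as
a cycle. -/
def IsAcyclic (G : Graph n) : Prop :=
  G.edges.Nodup ∧ (SimpleGraph.fromRel (fun u v => (u, v) ∈ G.edges)).IsAcyclic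

end Graph

/-! Newton polytopes. -/

/-- The Newton polytope: the convex hull of the exponent vectors of the monomials with nonzero
coefficient. -/
def newton {n : ℕ} (f : MvPolynomial (Fin n) ℤ) : Set (Fin n → ℝ) :=
  convexHull ℝ {x | ∃ m : Fin n →₀ ℕ, f.coeff m ≠ 0 ∧ x = fun i => (m i : ℝ)}

/-- Every integer point of the Newton polytope of `f` is the exponent of a monomial of `f`. -/
def HasPolytopalSupport {n : ℕ} (f : MvPolynomial (Fin n) ℤ) : Prop :=
  ∀ p : Fin n → ℤ, (fun i => (p i : ℝ)) ∈ newton f →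
    ∃ m : Fin n →₀ ℕ, (∀ i, (m i : ℤ) = p i) ∧ f.coeff m ≠ 0

/-- `f` is the integer-point transform of `P`, the sum of `t ^ p` over all integer points `p`
of `P`: no integer point of `P` has a negative coordinate, and the coefficient of `t ^ m` in `f`
is `1` if `m` lies in `P` and `0` otherwise. -/
def IsIntegerPointTransform {n : ℕ} (f : MvPolynomial (Fin n) ℤ) (P : Set (Fin n → ℝ)) : Prop :=
  (∀ p : Fin n → ℤ, (fun i => (p i : ℝ)) ∈ P → ∀ i, 0 ≤ p i) ∧
  ∀ m : Fin n →₀ ℕ,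
    ((fun i => (m i : ℝ)) ∈ P → f.coeff m = 1) ∧ ((fun i => (m i : ℝ)) ∉ P → f.coeff m = 0)

/-! Generalized permutahedra. -/

/-- The conditions on the parameters of a generalized permutahedron. -/
structure IsSupermodular {n : ℕ} (z : Finset (Fin n) → ℝ) : Prop where
  /-- the parameter of the empty set is zero -/
  empty : z ∅ = 0
  /-- supermodularity -/
  supermodular : ∀ I J : Finset (Fin n), z I + z J ≤ z (I ∪ J) + z (I ∩ J)

/-- The polytope with parameters `z`; for `z` with `IsSupermodular z` it is a generalized
permutahedron. -/
def genPermutahedron {n : ℕ} (z : Finset (Fin n) → ℝ) : Set (Fin n → ℝ) :=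
  {t | (∀ I : Finset (Fin n), I ≠ Finset.univ → z I ≤ ∑ i ∈ I, t i) ∧
    ∑ i, t i = z Finset.univ}

/-! Flows. -/

/-- The flow polytope of the directed multigraph with vertex set `V`, edges labelled by `E`, initial
vertices `ini` and final vertices `fin`, for the netflow vector `b`. -/
def flowPolytope {V E : Type} [DecidableEq V] [Fintype E] (ini fin : E → V) (b : V → ℝ) :
    Set (E → ℝ) :=
  {f | (∀ e, 0 ≤ f e) ∧
    ∀ v, (∑ e, if ini e = v then f e else 0) - (∑ e, if fin e = v then f e else 0) = b v}

namespace Graph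

variable {n : ℕ}

/-- The edges of `G` with the vertex `0` deleted. -/
def innerEdges (G : Graph n) : Multiset (Fin (n + 1) × Fin (n + 1)) :=
  G.edges.filter (fun e => e.1 ≠ 0)

/-- The edges of `G` with the vertex `0` deleted, the copies of a multiple edge being distinct. -/
abbrev InnerEdge (G : Graph n) : Type := G.innerEdges.ToType

theorem InnerEdge.fst_ne_zero {G : Graph n} (e : G.InnerEdge) : e.1.1 ≠ 0 :=
  (Multiset.mem_filter.1 (Multiset.coe_mem (m := G.innerEdges) (x := e))).2

theorem InnerEdge.snd_ne_zero {G : Graph n} (e : G.InnerEdge) : e.1.2 ≠ 0 := by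
  have h := G.increasing _
    (Multiset.mem_filter.1 (Multiset.coe_mem (m := G.innerEdges) (x := e))).1
  exact Fin.ne_zero_of_lt h

/-- The initial vertex of an edge of `G` without `0`, in the set `{1, …, n}` indexed by `Fin n`. -/
def InnerEdge.ini {G : Graph n} (e : G.InnerEdge) : Fin n := e.1.1.pred e.fst_ne_zero

/-- The final vertex of an edge of `G` without `0`, in the set `{1, …, n}` indexed by `Fin n`. -/
def InnerEdge.fin {G : Graph n} (e : G.InnerEdge) : Fin n := e.1.2.pred e.snd_ne_zero

/-- The labels of the edges of the two auxiliary graphs below: the edges `a j` for `j` in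
`{1, …, n}`, and the edges `z e` and `y e` for every edge `e` of `G` without `0`. -/
abbrev AuxEdge (G : Graph n) : Type := Fin n ⊕ (G.InnerEdge ⊕ G.InnerEdge)

/-- The edge `a j`. -/
def aEdge (G : Graph n) (j : Fin n) : G.AuxEdge := Sum.inl j

/-- The edge `y e`. -/
def yEdge (G : Graph n) (e : G.InnerEdge) : G.AuxEdge := Sum.inr (Sum.inr e)

/-- Initial vertices in the augmented graph, whose vertex set is `{1, …, n}` with an additional
sink `t`, written `⊤`: the edges `a j`, `z e`, `y e` start at `j`, `ini e`, `ini e`. -/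
def augIni (G : Graph n) : G.AuxEdge → WithTop (Fin n)
  | .inl j => (j : WithTop (Fin n))
  | .inr (.inl e) => (e.ini : WithTop (Fin n))
  | .inr (.inr e) => (e.ini : WithTop (Fin n))

/-- Final vertices in the augmented graph: the edges `a j`, `z e`, `y e` end at `t`, `fin e`,
`t`. -/
def augFin (G : Graph n) : G.AuxEdge → WithTop (Fin n)
  | .inl _ => ⊤
  | .inr (.inl e) => (e.fin : WithTop (Fin n))
  | .inr (.inr _) => ⊤

/-- The netflow vector `(indeg 1, …, indeg n, -#E(G))` on the augmented graph. -/
def augNetflow (G : Graph n) : WithTop (Fin n) → ℝ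
  | WithTop.some j => (G.indeg j.succ : ℝ)
  | ⊤ => -(G.numEdges : ℝ)

/-- The capacitated flow polytope of the augmented graph, with capacity `1` on the edges `y e`. -/
def augFlowPolytope (G : Graph n) : Set (G.AuxEdge → ℝ) :=
  {f | f ∈ flowPolytope G.augIni G.augFin G.augNetflow ∧ ∀ e, f (G.yEdge e) ≤ 1}

/-- Initial vertices in the graph `G^(k)`, whose vertex set is `{1, …, n, n + 1}` (indexed by
`Fin (n + 1)`) with an additional sink `t`, written `⊤`: the edges `a j`, `z e`, `y e` start at
`j`, `ini e`, `ini e`. -/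
def levelIni (G : Graph n) : G.AuxEdge → WithTop (Fin (n + 1))
  | .inl j => (j.castSucc : WithTop (Fin (n + 1)))
  | .inr (.inl e) => (e.ini.castSucc : WithTop (Fin (n + 1)))
  | .inr (.inr e) => (e.ini.castSucc : WithTop (Fin (n + 1)))

/-- Final vertices in the graph `G^(k)`: the edges `a j`, `z e`, `y e` end at `t`, `fin e`,
`n + 1`. -/
def levelFin (G : Graph n) : G.AuxEdge → WithTop (Fin (n + 1))
  | .inl _ => ⊤
  | .inr (.inl e) => (e.fin.castSucc : WithTop (Fin (n + 1)))
  | .inr (.inr _) => (Fin.last n : WithTop (Fin (n + 1)))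

/-- The netflow vector `(indeg 1, …, indeg n, -k, k - #E(G))` on the graph `G^(k)`. -/
def levelNetflow (G : Graph n) (k : ℕ) : WithTop (Fin (n + 1)) → ℝ
  | WithTop.some v => Fin.lastCases (motive := fun _ => ℝ) (-(k : ℝ))
      (fun j : Fin n => (G.indeg j.succ : ℝ)) v
  | ⊤ => (k : ℝ) - (G.numEdges : ℝ)

/-- The capacitated flow polytope of the graph `G^(k)`, with capacity `1` on the edges `y e`. -/
def levelFlowPolytope (G : Graph n) (k : ℕ) : Set (G.AuxEdge → ℝ) :=
  {f | f ∈ flowPolytope G.levelIni G.levelFin (G.levelNetflow k) ∧ ∀ e, f (G.yEdge e) ≤ 1}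

/-- The projection of a flow to its values on the edges `a 1, …, a n`. -/
def sinkProjection (G : Graph n) (f : G.AuxEdge → ℝ) : Fin n → ℝ := fun j => f (G.aEdge j)

/-- The values, over all capacitated flows on `G^(k)`, of the total flow on the edges `a i` with
`i` in `I`. -/
def sinkFlowValues (G : Graph n) (k : ℕ) (I : Finset (Fin n)) : Set ℝ :=
  {s | ∃ f ∈ G.levelFlowPolytope k, s = ∑ i ∈ I, f (G.aEdge i)}

/-- The least total flow on the edges `a i` with `i` in `I`. -/
def minSinkFlow (G : Graph n) (k : ℕ) (I : Finset (Fin n)) : ℝ := sInf (G.sinkFlowValues k I)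

end Graph

end LeftDegree

end

noncomputable section

namespace LeftDegree

/-! The multiplicity of `α` in the multiset of leaf sequences equals the number of integral
capacitated flows on the augmented graph whose values on the edges `a j` are `α`. This is
`ReductionTree.count_leftDegreeSeqs`, by induction on the tree. For a reduction on `a = (i,j)` and
`b = (j,k)`, comparing the flow on `a` with the flow on `b` splits the flows into three classes,
which correspond to the flows of the three children. A leaf admits only the zero flow, and its sink
values are the left-degrees. Flows do not mention the tree, so neither does the multiset.

All leaves with the same exponent have the same sign, so nothing cancels and the support of the
polynomial is the set of sink vectors of integral flows. A real flow with integral netflow is a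
convex combination of its integral roundings (`mem_convexHull_roundings`). Hence the Newton polytope
is the projected flow polytope. Rounding fixes coordinates that are already integral, so every
integer point of the projection lifts to an integral flow. The graph `G^(k)` cuts out the slice with
coordinate sum `#E(G) - k`.

For the generalized permutahedron, suppose that one flow has a smaller sum over `I` than another.
Then the latter can be changed by moving some sink flow from a point of `I` to a point outside
(`exists_level_exchange`). So a minimizer of a linear functional also minimizes the sums over all
its superlevel sets, which yields both supermodularity and the description by inequalities.

For a forest, flows of maximal total sink value have `y = 0`, and two of them with the same sink
values differ by a circulation, which vanishes. All multiplicities are then one. -/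

/-- The contribution of an edge `e` to the left-degree at the vertex `x`, when `z` units of flow are
sent along `e` and `y` units leave the graph at its initial vertex. -/
def edgeWeight {V : Type*} [DecidableEq V] (e : V × V) (z y : ℕ) (x : V) : ℤ :=
  (if e.2 = x then 1 + (z : ℤ) else 0) - (if e.1 = x then (z : ℤ) + y else 0)

/-- The integral capacitated flows with sink values `α` on the graph with edges `ed e`, `e ∈ s`. The
first component is the flow along the edges, the second one the flow leaving the graph. -/
def integerFlows {n : ℕ} {ι : Type*} (s : Finset ι)
    (ed : ι → Fin (n + 1) × Fin (n + 1)) (α : Fin n → ℕ) : Set ((ι → ℕ) × (ι → ℕ)) :=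
  {f | (∀ e, e ∉ s ∨ (ed e).1 = 0 → f.1 e = 0 ∧ f.2 e = 0) ∧ (∀ e, f.2 e ≤ 1) ∧
    ∀ j, (α j : ℤ) = ∑ e ∈ s, edgeWeight (ed e) (f.1 e) (f.2 e) j.succ}

/-! ### Integral flows under a reduction -/

section Reduction

variable {n : ℕ} {ι : Type*} [DecidableEq ι] {s : Finset ι}
  {ed : ι → Fin (n + 1) × Fin (n + 1)} {α : Fin n → ℕ} {a b : ι} {i j k : Fin (n + 1)}

theorem sum_split (ha : a ∈ s) (hb : b ∈ s) (hab : a ≠ b) (F : ι → ℤ) :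
    ∑ e ∈ s, F e = F a + F b + ∑ e ∈ (s.erase a).erase b, F e := by
  rw [← Finset.add_sum_erase s F ha,
    ← Finset.add_sum_erase (s.erase a) F (Finset.mem_erase.2 ⟨hab.symm, hb⟩), add_assoc]

/-- The flows on the first reduction, as flows on the original graph. -/
def liftFlow₁ (a b : ι) (f : (ι → ℕ) × (ι → ℕ)) : (ι → ℕ) × (ι → ℕ) :=
  (Function.update f.1 a (f.1 a + f.1 b + f.2 b), f.2)

/-- The flows on the second reduction, as flows on the original graph. -/
def liftFlow₂ (a b : ι) (f : (ι → ℕ) × (ι → ℕ)) : (ι → ℕ) × (ι → ℕ) :=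
  (Function.update f.1 b (f.1 b + f.1 a + 1), f.2)

/-- The flows on the third reduction, as flows on the original graph. -/
def liftFlow₃ (a b : ι) (f : (ι → ℕ) × (ι → ℕ)) : (ι → ℕ) × (ι → ℕ) :=
  (Function.update f.1 b (f.1 a), Function.update f.2 b 1)

/-- What the new edge `(i,k)` carries, and what leaves at its start, is sent along `a` to `j` first
and continues or leaves there. -/
theorem sum_liftFlow₁ (ha : a ∈ s) (hb : b ∈ s) (hab : a ≠ b) (hea : ed a = (i, j))
    (heb : ed b = (j, k)) (f : (ι → ℕ) × (ι → ℕ)) (x : Fin (n + 1)) :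
    ∑ e ∈ s, edgeWeight (ed e) ((liftFlow₁ a b f).1 e) ((liftFlow₁ a b f).2 e) x =
      ∑ e ∈ s, edgeWeight (Function.update ed b (i, k) e) (f.1 e) (f.2 e) x := by
  rw [sum_split ha hb hab, sum_split ha hb hab]
  congr 1
  · simp only [liftFlow₁, Function.update_self, Function.update_of_ne hab,
      Function.update_of_ne hab.symm, hea, heb, edgeWeight]
    split_ifs <;> push_cast <;> ring
  · refine Finset.sum_congr rfl fun e he => ?_
    simp only [Finset.mem_erase] at he
    simp [liftFlow₁, he.1, he.2.1]

/-- The flow of the new edge runs through `a` and then `b`. The extra unit on `b` carries to `k` the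
indegree that `a` contributes at `j`. -/
theorem sum_liftFlow₂ (ha : a ∈ s) (hb : b ∈ s) (hab : a ≠ b) (hea : ed a = (i, j))
    (heb : ed b = (j, k)) (f : (ι → ℕ) × (ι → ℕ)) (x : Fin (n + 1)) :
    ∑ e ∈ s, edgeWeight (ed e) ((liftFlow₂ a b f).1 e) ((liftFlow₂ a b f).2 e) x =
      ∑ e ∈ s, edgeWeight (Function.update ed a (i, k) e) (f.1 e) (f.2 e) x := by
  rw [sum_split ha hb hab, sum_split ha hb hab]
  congr 1
  · simp only [liftFlow₂, Function.update_self, Function.update_of_ne hab,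
      Function.update_of_ne hab.symm, hea, heb, edgeWeight]
    split_ifs <;> push_cast <;> ring
  · refine Finset.sum_congr rfl fun e he => ?_
    simp only [Finset.mem_erase] at he
    simp [liftFlow₂, he.1, he.2.1]

/-- The flow on the new edge runs through `a` and `b`; the indegree contributed by `a` at `j` leaves
through `y` of `b`. -/
theorem sum_liftFlow₃ (ha : a ∈ s) (hb : b ∈ s) (hab : a ≠ b) (hea : ed a = (i, j))
    (heb : ed b = (j, k)) (f : (ι → ℕ) × (ι → ℕ)) (x : Fin (n + 1)) :
    ∑ e ∈ s, edgeWeight (ed e) ((liftFlow₃ a b f).1 e) ((liftFlow₃ a b f).2 e) x =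
      ∑ e ∈ s.erase b, edgeWeight (Function.update ed a (i, k) e) (f.1 e) (f.2 e) x := by
  rw [sum_split ha hb hab, ← Finset.add_sum_erase (s.erase b) _ (Finset.mem_erase.2 ⟨hab, ha⟩),
    Finset.erase_right_comm]
  congr 1
  · simp only [liftFlow₃, Function.update_self, Function.update_of_ne hab, hea, heb, edgeWeight]
    split_ifs <;> push_cast <;> ring
  · refine Finset.sum_congr rfl fun e he => ?_
    simp only [Finset.mem_erase] at he
    simp [liftFlow₃, he.1, he.2.1]

theorem liftFlow₁_injective (hab : a ≠ b) : Function.Injective (liftFlow₁ a b) := by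
  rintro ⟨z, y⟩ ⟨z', y'⟩ h
  simp only [liftFlow₁, Prod.mk.injEq] at h
  obtain ⟨h, rfl⟩ := h
  refine Prod.ext (funext fun e => ?_) rfl
  have h0 := congrFun h e
  have hb := congrFun h b
  simp only [Function.update_of_ne hab.symm] at hb
  by_cases he : e = a
  · subst he
    simp only [Function.update_self] at h0
    simp only
    omega
  · simpa [he] using h0

theorem liftFlow₂_injective (hab : a ≠ b) : Function.Injective (liftFlow₂ a b) := by
  rintro ⟨z, y⟩ ⟨z', y'⟩ h
  simp only [liftFlow₂, Prod.mk.injEq] at h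
  obtain ⟨h, rfl⟩ := h
  refine Prod.ext (funext fun e => ?_) rfl
  have h0 := congrFun h e
  have hb := congrFun h a
  simp only [Function.update_of_ne hab] at hb
  by_cases he : e = b
  · subst he
    simp only [Function.update_self] at h0
    simp only
    omega
  · simpa [he] using h0

/-- The lift overwrites both values at `b`, but flows on `s.erase b` vanish there, so nothing is
lost. -/
theorem liftFlow₃_injOn {ed' : ι → Fin (n + 1) × Fin (n + 1)} :
    Set.InjOn (liftFlow₃ a b) (integerFlows (s.erase b) ed' α) := by
  rintro ⟨z, y⟩ hf ⟨z', y'⟩ hf' h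
  simp only [liftFlow₃, Prod.mk.injEq] at h
  have h1 := hf.1 b (Or.inl (by simp))
  have h2 := hf'.1 b (Or.inl (by simp))
  simp only at h1 h2
  refine Prod.ext (funext fun e => ?_) (funext fun e => ?_)
  · by_cases he : e = b
    · simp only [he, h1.1, h2.1]
    · simpa [he] using congrFun h.1 e
  · by_cases he : e = b
    · simp only [he, h1.2, h2.2]
    · simpa [he] using congrFun h.2 e

/-- The inverse subtracts `f.1 b + f.2 b` at `a`, which the inequality permits. If `i = 0`, the new
edge must carry nothing; on the right-hand side this follows from `f.1 a = 0` and the inequality. -/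
theorem liftFlow₁_image (ha : a ∈ s) (hb : b ∈ s) (hab : a ≠ b) (hea : ed a = (i, j))
    (heb : ed b = (j, k)) (hj : j ≠ 0) :
    liftFlow₁ a b '' integerFlows s (Function.update ed b (i, k)) α =
      {f ∈ integerFlows s ed α | f.1 b + f.2 b ≤ f.1 a} := by
  ext f
  constructor
  · rintro ⟨f, ⟨h1, h2, h3⟩, rfl⟩
    refine ⟨⟨fun e he => ?_, h2, fun x => ?_⟩, ?_⟩
    · have hb0 := h1 b
      simp only [Function.update_self] at hb0
      by_cases hea' : e = a
      · subst hea'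
        have h0 := h1 e
        simp only [Function.update_of_ne hab] at h0
        rw [hea] at he h0
        simp only [ha, not_true_eq_false, false_or] at he
        have h4 := h0 (Or.inr he)
        have h5 := hb0 (Or.inr he)
        simp [liftFlow₁, h4, h5]
      · by_cases heb' : e = b
        · subst heb'
          rw [heb] at he
          simp [hb, hj] at he
        · have h0 := h1 e
          rw [Function.update_of_ne heb'] at h0
          simpa [liftFlow₁, hea'] using h0 he
    · rw [sum_liftFlow₁ ha hb hab hea heb]; exact h3 x
    · simp only [liftFlow₁, Function.update_self, Function.update_of_ne hab.symm]; omega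
  · rintro ⟨⟨h1, h2, h3⟩, h⟩
    have hf : liftFlow₁ a b (Function.update f.1 a (f.1 a - f.1 b - f.2 b), f.2) = f := by
      refine Prod.ext (funext fun e => ?_) rfl
      by_cases hea' : e = a
      · subst hea'
        simp only [liftFlow₁, Function.update_self, Function.update_of_ne hab.symm]; omega
      · simp [liftFlow₁, hea']
    refine ⟨(Function.update f.1 a (f.1 a - f.1 b - f.2 b), f.2), ⟨fun e he => ?_, h2, fun x => ?_⟩, hf⟩
    · have ha0 := h1 a
      rw [hea] at ha0
      by_cases heb' : e = b
      · subst heb'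
        simp only [hb, not_true_eq_false, Function.update_self, false_or] at he
        have h4 := ha0 (Or.inr he)
        simp only [Function.update_of_ne hab.symm]
        omega
      · rw [Function.update_of_ne heb'] at he
        have h4 := h1 e he
        by_cases hea' : e = a
        · subst hea'
          simp only [Function.update_self]
          omega
        · simpa [hea'] using h4
    · rw [← sum_liftFlow₁ ha hb hab hea heb, hf]; exact h3 x

theorem liftFlow₂_image (ha : a ∈ s) (hb : b ∈ s) (hab : a ≠ b) (hea : ed a = (i, j))
    (heb : ed b = (j, k)) (hj : j ≠ 0) :
    liftFlow₂ a b '' integerFlows s (Function.update ed a (i, k)) α =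
      {f ∈ integerFlows s ed α | f.1 a < f.1 b} := by
  have key : ∀ e, e ≠ b →
      ((e ∉ s ∨ (Function.update ed a (i, k) e).1 = 0) ↔ (e ∉ s ∨ (ed e).1 = 0)) := by
    intro e _
    by_cases hea' : e = a
    · subst hea'; simp [hea]
    · simp [hea']
  have keyb : ¬ (b ∉ s ∨ (ed b).1 = 0) := by simp [hb, heb, hj]
  have keyb' : ¬ (b ∉ s ∨ (Function.update ed a (i, k) b).1 = 0) := by
    rwa [Function.update_of_ne hab.symm]
  ext f
  constructor
  · rintro ⟨f, ⟨h1, h2, h3⟩, rfl⟩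
    refine ⟨⟨fun e he => ?_, h2, fun x => ?_⟩, ?_⟩
    · by_cases heb' : e = b
      · subst heb'; exact absurd he keyb
      · simpa [liftFlow₂, heb'] using h1 e ((key e heb').2 he)
    · rw [sum_liftFlow₂ ha hb hab hea heb]; exact h3 x
    · simp only [liftFlow₂, Function.update_self, Function.update_of_ne hab]; omega
  · rintro ⟨⟨h1, h2, h3⟩, h⟩
    have hf : liftFlow₂ a b (Function.update f.1 b (f.1 b - f.1 a - 1), f.2) = f := by
      refine Prod.ext (funext fun e => ?_) rfl
      by_cases heb' : e = b
      · subst heb'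
        simp only [liftFlow₂, Function.update_self, Function.update_of_ne hab]; omega
      · simp [liftFlow₂, heb']
    refine ⟨(Function.update f.1 b (f.1 b - f.1 a - 1), f.2),
      ⟨fun e he => ?_, h2, fun x => ?_⟩, hf⟩
    · by_cases heb' : e = b
      · subst heb'; exact absurd he keyb'
      · simpa [heb'] using h1 e ((key e heb').1 he)
    · rw [← sum_liftFlow₂ ha hb hab hea heb, hf]; exact h3 x

theorem liftFlow₃_image (ha : a ∈ s) (hb : b ∈ s) (hab : a ≠ b) (hea : ed a = (i, j))
    (heb : ed b = (j, k)) (hj : j ≠ 0) :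
    liftFlow₃ a b '' integerFlows (s.erase b) (Function.update ed a (i, k)) α =
      {f ∈ integerFlows s ed α | f.1 b = f.1 a ∧ f.2 b = 1} := by
  have key : ∀ e, e ≠ b →
      ((e ∉ s.erase b ∨ (Function.update ed a (i, k) e).1 = 0) ↔ (e ∉ s ∨ (ed e).1 = 0)) := by
    intro e heb'
    by_cases hea' : e = a
    · subst hea'; simp [hea, hab]
    · simp [hea', heb']
  have keyb : ¬ (b ∉ s ∨ (ed b).1 = 0) := by simp [hb, heb, hj]
  ext f
  constructor
  · rintro ⟨f, ⟨h1, h2, h3⟩, rfl⟩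
    refine ⟨⟨fun e he => ?_, fun e => ?_, fun x => ?_⟩, ?_⟩
    · by_cases heb' : e = b
      · subst heb'; exact absurd he keyb
      · simpa [liftFlow₃, heb'] using h1 e ((key e heb').2 he)
    · by_cases heb' : e = b
      · simp [liftFlow₃, heb']
      · simpa [liftFlow₃, heb'] using h2 e
    · rw [sum_liftFlow₃ ha hb hab hea heb]; exact h3 x
    · simp [liftFlow₃, Function.update_of_ne hab]
  · rintro ⟨⟨h1, h2, h3⟩, h⟩
    have hf : liftFlow₃ a b (Function.update f.1 b 0, Function.update f.2 b 0) = f := by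
      refine Prod.ext (funext fun e => ?_) (funext fun e => ?_)
      · by_cases heb' : e = b
        · subst heb'
          simp [liftFlow₃, hab, h.1]
        · simp [liftFlow₃, heb']
      · by_cases heb' : e = b
        · subst heb'
          simp [liftFlow₃, h.2]
        · simp [liftFlow₃, heb']
    refine ⟨_, ⟨fun e he => ?_, fun e => ?_, fun x => ?_⟩, hf⟩
    · by_cases heb' : e = b
      · simp [heb']
      · simpa [heb'] using h1 e ((key e heb').1 he)
    · by_cases heb' : e = b
      · simp [heb']
      · simpa [heb'] using h2 e
    · rw [← sum_liftFlow₃ ha hb hab hea heb, hf]; exact h3 x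

/-- Since `f.2 b ≤ 1`, exactly one of the conditions `f.1 b + f.2 b ≤ f.1 a`, `f.1 a < f.1 b`, and
`f.1 b = f.1 a` with `f.2 b = 1` holds. With `encard` no finiteness is needed beforehand. -/
theorem encard_integerFlows_reduce (ha : a ∈ s) (hb : b ∈ s) (hab : a ≠ b) (hea : ed a = (i, j))
    (heb : ed b = (j, k)) (hj : j ≠ 0) :
    (integerFlows s ed α).encard =
      (integerFlows s (Function.update ed b (i, k)) α).encard +
      (integerFlows s (Function.update ed a (i, k)) α).encard +
      (integerFlows (s.erase b) (Function.update ed a (i, k)) α).encard := by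
  rw [← (liftFlow₁_injective hab).encard_image (integerFlows s (Function.update ed b (i, k)) α),
    ← (liftFlow₂_injective hab).encard_image (integerFlows s (Function.update ed a (i, k)) α),
    ← (liftFlow₃_injOn (a := a)).encard_image, liftFlow₁_image ha hb hab hea heb hj,
    liftFlow₂_image ha hb hab hea heb hj, liftFlow₃_image ha hb hab hea heb hj,
    ← Set.encard_union_eq, ← Set.encard_union_eq]
  · congr 1
    ext f
    simp only [Set.mem_union, Set.mem_ofPred_eq]
    constructor
    · intro hf
      have := hf.2.1 b
      simp only [hf, true_and]
      omega
    · rintro ((h | h) | h) <;> exact h.1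
  · rw [Set.disjoint_left]
    rintro f (h | h) ⟨_, h'⟩
    · have := h.2; omega
    · have := h.2; omega
  · rw [Set.disjoint_left]
    rintro f h ⟨_, h'⟩
    have := h.2; omega

end Reduction

/-- No edge enters the initial vertex of `e`, so all weights there are nonpositive, while their sum
is an entry of `α`. Hence nothing flows out along `e`. -/
theorem integerFlows_eq_zero_of_irreducible {n : ℕ} {ι : Type*} {s : Finset ι}
    {ed : ι → Fin (n + 1) × Fin (n + 1)} {α : Fin n → ℕ}
    (hs : ∀ e ∈ s, ∀ e' ∈ s, (ed e').2 ≠ (ed e).1) {f : (ι → ℕ) × (ι → ℕ)}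
    (hf : f ∈ integerFlows s ed α) : f = 0 := by
  obtain ⟨h1, _, h3⟩ := hf
  have key : ∀ e, f.1 e = 0 ∧ f.2 e = 0 := by
    intro e
    by_cases he : e ∉ s ∨ (ed e).1 = 0
    · exact h1 e he
    · push Not at he
      have h4 := h3 ((ed e).1.pred he.2)
      rw [Fin.succ_pred] at h4
      have h5 : ∀ e' ∈ s, edgeWeight (ed e') (f.1 e') (f.2 e') (ed e).1 ≤ 0 := by
        intro e' he'
        rw [edgeWeight, if_neg (hs e he.1 e' he')]
        split_ifs <;> omega
      have h6 := Finset.sum_le_sum_of_subset_of_nonneg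
        (f := fun e' => - edgeWeight (ed e') (f.1 e') (f.2 e') (ed e).1)
        (Finset.singleton_subset_iff.2 he.1) (fun e' he' _ => neg_nonneg.2 (h5 e' he'))
      rw [Finset.sum_singleton, Finset.sum_neg_distrib, ← h4, edgeWeight, if_neg (hs e he.1 e he.1),
        if_pos rfl] at h6
      omega
  exact Prod.ext (funext fun e => (key e).1) (funext fun e => (key e).2)

theorem sum_edgeWeight_zero {V ι : Type*} [DecidableEq V] (s : Finset ι) (ed : ι → V × V) (x : V) :
    ∑ e ∈ s, edgeWeight (ed e) 0 0 x = (s.val.map ed).countP (fun e => e.2 = x) := by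
  rw [Multiset.countP_map, ← Finset.filter_val, Finset.card_val, Finset.card_filter]
  simp [edgeWeight]

/-- The multiplicity of a left-degree sequence is the number of integral flows that project to it,
for every reduction tree. -/
theorem ReductionTree.count_leftDegreeSeqs {n : ℕ} {G : Graph n} (T : ReductionTree G) {ι : Type*}
    [DecidableEq ι] (s : Finset ι) (ed : ι → Fin (n + 1) × Fin (n + 1))
    (hs : s.val.map ed = G.edges) (α : Fin n → ℕ) :
    (T.leftDegreeSeqs.count α : ℕ∞) = (integerFlows s ed α).encard := by
  -- Reductions change the ends of a labelled edge or drop a label, so the labelling has to vary.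
  induction T generalizing s ed with
  | leaf G h =>
    have h0 : ∀ f ∈ integerFlows s ed α, f = 0 := by
      intro f hf
      refine integerFlows_eq_zero_of_irreducible (fun e he e' he' heq => ?_) hf
      have m1 : ed e ∈ G.edges := hs ▸ Multiset.mem_map_of_mem ed he
      have m2 : ed e' ∈ G.edges := hs ▸ Multiset.mem_map_of_mem ed he'
      exact h (ed e').1 (ed e').2 (ed e).2 m2 (heq ▸ m1)
    have hz : (0 : (ι → ℕ) × (ι → ℕ)) ∈ integerFlows s ed α ↔ α = G.leftDegreeSeq := by
      have h5 : ∀ x, ∑ e ∈ s, edgeWeight (ed e) 0 0 x = G.indeg x := by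
        intro x; rw [sum_edgeWeight_zero, hs]; rfl
      simp only [integerFlows, Set.mem_ofPred_eq, Prod.fst_zero, Prod.snd_zero, Pi.zero_apply, h5,
        and_self, implies_true, zero_le, true_and, Nat.cast_inj]
      exact funext_iff.symm
    simp only [leftDegreeSeqs, Multiset.count_singleton]
    split_ifs with hα
    · have : integerFlows s ed α = {0} :=
        Set.eq_singleton_iff_unique_mem.2 ⟨hz.2 hα, h0⟩
      simp [this]
    · have : integerFlows s ed α = ∅ := by
        refine Set.eq_empty_of_forall_notMem fun f hf => hα (hz.1 ?_)
        rwa [h0 f hf] at hf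
      simp [this]
  | node G i j k hij hjk T₁ T₂ T₃ ih₁ ih₂ ih₃ =>
    have hij' : i < j := G.increasing _ hij
    obtain ⟨a, ha, hea⟩ := Multiset.mem_map.1 (hs ▸ hij)
    obtain ⟨b, hb, heb⟩ := Multiset.mem_map.1 (hs ▸ hjk)
    have hab : a ≠ b := by
      rintro rfl
      rw [hea] at heb
      exact hij'.ne (congrArg Prod.fst heb)
    have haE : G.edges.erase (i, j) = (s.erase a).val.map ed := by
      rw [← hs, Finset.erase_val, ← hea, ← Multiset.map_erase_of_mem ed _ ha]
    have hbE : G.edges.erase (j, k) = (s.erase b).val.map ed := by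
      rw [← hs, Finset.erase_val, ← heb, ← Multiset.map_erase_of_mem ed _ hb]
    have habE : (G.edges.erase (i, j)).erase (j, k) = ((s.erase b).erase a).val.map ed := by
      rw [haE, ← heb, Finset.erase_right_comm, Finset.erase_val (s.erase a),
        Multiset.map_erase_of_mem ed _ (Finset.mem_erase.2 ⟨hab.symm, hb⟩)]
    have upd : ∀ (t : Finset ι) (c : ι), c ∈ t → ∀ p,
        t.val.map (Function.update ed c p) = p ::ₘ (t.erase c).val.map ed := by
      intro t c hc p
      conv_lhs => rw [← Finset.insert_erase hc]
      rw [Finset.insert_val_of_notMem (Finset.notMem_erase _ _), Multiset.map_cons,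
        Function.update_self]
      congr 1
      refine Multiset.map_congr rfl fun e he => ?_
      exact Function.update_of_ne (Finset.ne_of_mem_erase he) _ _
    have hj0 : j ≠ 0 := Fin.ne_zero_of_lt hij'
    rw [encard_integerFlows_reduce ha hb hab hea heb hj0,
      ← ih₁ s _ (by rw [upd s b hb, ← hbE]; rfl), ← ih₂ s _ (by rw [upd s a ha, ← haE]; rfl),
      ← ih₃ (s.erase b) _ (by
        rw [upd _ a (Finset.mem_erase.2 ⟨hab, ha⟩), ← habE]; rfl)]
    simp [leftDegreeSeqs]

/-! ### Integrality of flows -/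

section Netflow

variable {V E : Type*} [DecidableEq V] [Fintype E]

/-- The netflow of a real vector on the edges, as a linear map. -/
def netflow (ini fin : E → V) : (E → ℝ) →ₗ[ℝ] (V → ℝ) where
  toFun f v := ∑ e, ((if ini e = v then f e else 0) - (if fin e = v then f e else 0))
  map_add' f g := by
    funext v
    rw [Pi.add_apply, ← Finset.sum_add_distrib]
    refine Finset.sum_congr rfl fun e _ => ?_
    simp only [Pi.add_apply]
    split_ifs <;> ring
  map_smul' c f := by
    funext v
    simp only [Pi.smul_apply, smul_eq_mul, RingHom.id_apply, Finset.mul_sum]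
    refine Finset.sum_congr rfl fun e _ => ?_
    split_ifs <;> ring

theorem netflow_apply (ini fin : E → V) (f : E → ℝ) (v : V) : netflow ini fin f v =
    ∑ e, ((if ini e = v then f e else 0) - (if fin e = v then f e else 0)) := rfl

theorem mem_flowPolytope {V E : Type} [DecidableEq V] [Fintype E] {ini fin : E → V} {b : V → ℝ}
    {f : E → ℝ} :
    f ∈ flowPolytope ini fin b ↔ (∀ e, 0 ≤ f e) ∧ netflow ini fin f = b := by
  simp only [flowPolytope, Set.mem_ofPred_eq, funext_iff, netflow_apply, Finset.sum_sub_distrib]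

theorem sum_netflow [Fintype V] (ini fin : E → V) (f : E → ℝ) : ∑ v, netflow ini fin f v = 0 := by
  simp only [netflow_apply]
  rw [Finset.sum_comm]
  simp

/-- Minimal degree two gives at least as many edges as vertices. Netflows sum to zero, so one vertex
condition is redundant, and a linear system with fewer equations than unknowns remains. -/
theorem exists_circulation_of_two_le_degree [Fintype V] {ini fin : E → V} {F : Finset E}
    (hF : F.Nonempty)
    (hdeg : ∀ e ∈ F, ∀ v, ini e = v ∨ fin e = v → ∃ e' ∈ F, e' ≠ e ∧ (ini e' = v ∨ fin e' = v)) :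
    ∃ d : E → ℝ, d ≠ 0 ∧ (∀ e, e ∉ F → d e = 0) ∧ netflow ini fin d = 0 := by
  classical
  set W : Finset V := F.image ini ∪ F.image fin with hW
  have hini : ∀ e ∈ F, ini e ∈ W := fun e he =>
    Finset.mem_union_left _ (Finset.mem_image_of_mem _ he)
  have hfin : ∀ e ∈ F, fin e ∈ W := fun e he =>
    Finset.mem_union_right _ (Finset.mem_image_of_mem _ he)
  have hcard : W.card ≤ F.card := by
    have h1 := Finset.card_eq_sum_card_fiberwise hini
    have h2 := Finset.card_eq_sum_card_fiberwise hfin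
    have h3 : ∀ v ∈ W, 2 ≤ (F.filter (fun e => ini e = v)).card +
        (F.filter (fun e => fin e = v)).card := by
      intro v hv
      obtain ⟨e, he, hev⟩ : ∃ e ∈ F, ini e = v ∨ fin e = v := by
        rcases Finset.mem_union.1 hv with h | h
        · obtain ⟨e, he, h⟩ := Finset.mem_image.1 h
          exact ⟨e, he, Or.inl h⟩
        · obtain ⟨e, he, h⟩ := Finset.mem_image.1 h
          exact ⟨e, he, Or.inr h⟩
      obtain ⟨e', he', hee, hev'⟩ := hdeg e he v hev
      refine le_trans ?_ (Finset.card_union_le _ _)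
      rw [← Finset.filter_or, ← Finset.card_pair hee]
      refine Finset.card_le_card fun x hx => ?_
      rcases Finset.mem_insert.1 hx with rfl | hx
      · exact Finset.mem_filter.2 ⟨he', hev'⟩
      · rw [Finset.mem_singleton] at hx
        subst hx
        exact Finset.mem_filter.2 ⟨he, hev⟩
    have h4 := Finset.sum_le_sum h3
    rw [Finset.sum_add_distrib, ← h1, ← h2, Finset.sum_const, smul_eq_mul] at h4
    omega
  obtain ⟨e₀, he₀⟩ := hF
  set v₀ := ini e₀
  have hv₀ : v₀ ∈ W := hini e₀ he₀
  let ext : (F → ℝ) →ₗ[ℝ] (E → ℝ) := Function.ExtendByZero.linearMap ℝ (Subtype.val : F → E)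
  let L : (F → ℝ) →ₗ[ℝ] (W.erase v₀ → ℝ) :=
    (LinearMap.funLeft ℝ ℝ (Subtype.val : W.erase v₀ → V)) ∘ₗ netflow ini fin ∘ₗ ext
  have hker : LinearMap.ker L ≠ ⊥ := by
    refine LinearMap.ker_ne_bot_of_finrank_lt ?_
    rw [Module.finrank_fintype_fun_eq_card, Module.finrank_fintype_fun_eq_card, Fintype.card_coe,
      Fintype.card_coe, Finset.card_erase_of_mem hv₀]
    have := Finset.card_pos.2 ⟨v₀, hv₀⟩
    omega
  obtain ⟨x, hx, hx0⟩ := (Submodule.ne_bot_iff _).1 hker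
  have hoff : ∀ e, e ∉ F → ext x e = 0 := by
    intro e he
    refine Function.extend_apply' _ _ _ ?_
    rintro ⟨⟨e', he'⟩, rfl⟩
    exact he he'
  have hon : ∀ e : F, ext x e = x e := fun e => Subtype.val_injective.extend_apply x 0 e
  have hzero : ∀ v, v ≠ v₀ → netflow ini fin (ext x) v = 0 := by
    intro v hv
    by_cases hvW : v ∈ W
    · exact congrFun (LinearMap.mem_ker.1 hx) ⟨v, Finset.mem_erase.2 ⟨hv, hvW⟩⟩
    · rw [netflow_apply]
      refine Finset.sum_eq_zero fun e _ => ?_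
      by_cases he : e ∈ F
      · rw [if_neg (fun h : ini e = v => hvW (h ▸ hini e he)),
          if_neg (fun h : fin e = v => hvW (h ▸ hfin e he)), sub_zero]
      · simp [hoff e he]
  refine ⟨ext x, ?_, hoff, ?_⟩
  · intro h
    refine hx0 (funext fun e => ?_)
    rw [← hon e, h]
    rfl
  · funext v
    by_cases hv : v = v₀
    · have h := sum_netflow ini fin (ext x)
      rw [← Finset.add_sum_erase _ _ (Finset.mem_univ v₀),
        Finset.sum_eq_zero (fun v hv => hzero v (Finset.ne_of_mem_erase hv)), add_zero] at h
      rw [hv, h]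
      rfl
    · exact hzero v hv

/-- The coordinates of `f` that are not integers. -/
def fractional (f : E → ℝ) : Finset E := by
  classical exact Finset.univ.filter fun e => ¬ ∃ m : ℤ, f e = m

theorem mem_fractional {f : E → ℝ} {e : E} : e ∈ fractional f ↔ ¬ ∃ m : ℤ, f e = m := by
  classical simp [fractional]

/-- If `e` were the only fractional edge at `v`, the integral netflow at `v` would be an integer
plus or minus `f e`. -/
theorem fractional_degree {ini fin : E → V} (hne : ∀ e, ini e ≠ fin e) {f : E → ℝ}
    (hf : ∀ v, ∃ m : ℤ, netflow ini fin f v = m) :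
    ∀ e ∈ fractional f, ∀ v, ini e = v ∨ fin e = v →
      ∃ e' ∈ fractional f, e' ≠ e ∧ (ini e' = v ∨ fin e' = v) := by
  classical
  intro e he v hv
  by_contra! hcon
  let H : AddSubgroup ℝ := (Int.castAddHom ℝ).range
  have hH : ∀ x : ℝ, x ∈ H ↔ ∃ m : ℤ, x = m := fun x => by
    simp only [H, AddMonoidHom.mem_range, Int.coe_castAddHom, eq_comm]
  have h1 := hf v
  rw [netflow_apply, ← hH, ← Finset.add_sum_erase _ _ (Finset.mem_univ e)] at h1
  have h2 : ∑ e' ∈ Finset.univ.erase e,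
      ((if ini e' = v then f e' else 0) - (if fin e' = v then f e' else 0)) ∈ H := by
    refine sum_mem fun e' he' => ?_
    by_cases hfr : e' ∈ fractional f
    · obtain ⟨h3, h4⟩ := hcon e' hfr (Finset.ne_of_mem_erase he')
      rw [if_neg h3, if_neg h4, sub_zero]
      exact H.zero_mem
    · rw [mem_fractional, not_not, ← hH] at hfr
      exact H.sub_mem (by split_ifs; exacts [hfr, H.zero_mem])
        (by split_ifs; exacts [hfr, H.zero_mem])
  have h3 := (H.add_mem_cancel_right h2).1 h1
  refine mem_fractional.1 he ((hH _).1 ?_)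
  rcases hv with hv | hv
  · rwa [if_pos hv, if_neg (fun h => hne e (hv.trans h.symm)), sub_zero] at h3
  · rw [if_pos hv, if_neg (fun h => hne e (h.trans hv.symm)), zero_sub] at h3
    exact H.neg_mem_iff.1 h3

/-- Moving from `f` in a direction supported on the fractional coordinates until some coordinate
becomes an integer. -/
theorem exists_step_to_integer {f d : E → ℝ} (hd : d ≠ 0) (hsupp : ∀ e, e ∉ fractional f → d e = 0) :
    ∃ t : ℝ, 0 < t ∧ (∀ e, (⌊f e⌋ : ℝ) ≤ f e + t * d e ∧ f e + t * d e ≤ ⌈f e⌉) ∧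
      ∃ e ∈ fractional f, ∃ m : ℤ, f e + t * d e = m := by
  classical
  -- The time at which the coordinate `e` reaches the next integer. It is meaningless for `d e = 0`;
  -- such edges are left out of the minimum.
  let τ : E → ℝ := fun e => if 0 < d e then (⌈f e⌉ - f e) / d e else (⌊f e⌋ - f e) / d e
  have hfl : ∀ e, d e ≠ 0 → (⌊f e⌋ : ℝ) < f e ∧ f e < ⌈f e⌉ := by
    intro e he
    have h1 : e ∈ fractional f := by_contra fun h => he (hsupp e h)
    rw [mem_fractional] at h1
    exact ⟨lt_of_le_of_ne (Int.floor_le _) fun h => h1 ⟨_, h.symm⟩,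
      lt_of_le_of_ne (Int.le_ceil _) fun h => h1 ⟨_, h⟩⟩
  obtain ⟨e₁, he₁⟩ := Function.ne_iff.1 hd
  obtain ⟨e₀, he₀, hmin⟩ := Finset.exists_min_image (Finset.univ.filter fun e => d e ≠ 0) τ
    ⟨e₁, by simpa using he₁⟩
  have he₀' : d e₀ ≠ 0 := by simpa using he₀
  have hpos : 0 < τ e₀ := by
    simp only [τ]
    split_ifs with h
    · exact div_pos (sub_pos.2 (hfl _ he₀').2) h
    · exact div_pos_of_neg_of_neg (sub_neg.2 (hfl _ he₀').1) (lt_of_le_of_ne (not_lt.1 h) he₀')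
  refine ⟨τ e₀, hpos, fun e => ?_, e₀, by_contra fun h => he₀' (hsupp _ h), ?_⟩
  · by_cases he : d e = 0
    · rw [he, mul_zero, add_zero]
      exact ⟨Int.floor_le _, Int.le_ceil _⟩
    · have h1 := hmin e (by simpa using he)
      obtain ⟨h2, h3⟩ := hfl e he
      rcases lt_or_gt_of_ne he with h | h
      · have h4 : τ e = (⌊f e⌋ - f e) / d e := if_neg (not_lt.2 h.le)
        rw [h4, le_div_iff_of_neg h] at h1
        have := mul_neg_of_pos_of_neg hpos h
        constructor <;> linarith
      · have h4 : τ e = (⌈f e⌉ - f e) / d e := if_pos h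
        rw [h4, le_div_iff₀ h] at h1
        have := mul_pos hpos h
        constructor <;> linarith
  · by_cases h : 0 < d e₀
    · refine ⟨⌈f e₀⌉, ?_⟩
      have h4 : τ e₀ = (⌈f e₀⌉ - f e₀) / d e₀ := if_pos h
      rw [h4, div_mul_cancel₀ _ he₀']
      ring
    · refine ⟨⌊f e₀⌋, ?_⟩
      have h4 : τ e₀ = (⌊f e₀⌋ - f e₀) / d e₀ := if_neg h
      rw [h4, div_mul_cancel₀ _ he₀']
      ring

/-- The integral vectors with the same netflow as `f` in the smallest integral box around `f`. -/
def roundings (ini fin : E → V) (f : E → ℝ) : Set (E → ℝ) :=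
  {g | (∀ e, ∃ m : ℤ, g e = m) ∧ netflow ini fin g = netflow ini fin f ∧
    ∀ e, (⌊f e⌋ : ℝ) ≤ g e ∧ g e ≤ ⌈f e⌉}

/-- A real vector with integral netflow is a convex combination of its roundings. -/
theorem mem_convexHull_roundings [Fintype V] {ini fin : E → V} (hne : ∀ e, ini e ≠ fin e)
    {f : E → ℝ} (hf : ∀ v, ∃ m : ℤ, netflow ini fin f v = m) :
    f ∈ convexHull ℝ (roundings ini fin f) := by
  induction hN : (fractional f).card using Nat.strong_induction_on generalizing f with
  | _ N ih =>
    rcases (fractional f).eq_empty_or_nonempty with hF | hF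
    · refine subset_convexHull ℝ _ ⟨fun e => ?_, rfl, fun e => ⟨Int.floor_le _, Int.le_ceil _⟩⟩
      by_contra h
      have := mem_fractional.2 h
      simp [hF] at this
    · obtain ⟨d, hd, hsupp, hcirc⟩ :=
        exists_circulation_of_two_le_degree hF (fractional_degree hne hf)
      -- Used for `d` and `-d`: both endpoints have fewer fractional coordinates and stay in the
      -- integral box of `f`, so their roundings are roundings of `f`. The vector `f` lies between
      -- them.
      have step : ∀ d : E → ℝ, d ≠ 0 → (∀ e, e ∉ fractional f → d e = 0) →
          netflow ini fin d = 0 →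
          ∃ t : ℝ, 0 < t ∧ f + t • d ∈ convexHull ℝ (roundings ini fin f) := by
        intro d hd hsupp hcirc
        obtain ⟨t, ht, hbox, e₀, he₀, hint⟩ := exists_step_to_integer hd hsupp
        have hnet : netflow ini fin (f + t • d) = netflow ini fin f := by
          rw [map_add, map_smul, hcirc, smul_zero, add_zero]
        refine ⟨t, ht, ?_⟩
        have hsub : fractional (f + t • d) ⊆ fractional f := by
          intro e he
          by_contra h
          rw [mem_fractional] at he
          refine he ?_
          simpa [hsupp e h] using not_not.1 (mem_fractional.not.1 h)
        have hlt : (fractional (f + t • d)).card < N := by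
          rw [← hN]
          refine Finset.card_lt_card ⟨hsub, fun h => ?_⟩
          exact mem_fractional.1 (h he₀) hint
        have h1 := ih _ hlt (f := f + t • d) (by rwa [hnet]) rfl
        refine convexHull_mono ?_ h1
        rintro g ⟨hg1, hg2, hg3⟩
        refine ⟨hg1, hg2.trans hnet, fun e => ⟨le_trans ?_ (hg3 e).1, (hg3 e).2.trans ?_⟩⟩
        · exact_mod_cast Int.le_floor.2 (hbox e).1
        · exact_mod_cast Int.ceil_le.2 (hbox e).2
      obtain ⟨t, ht, h1⟩ := step d hd hsupp hcirc
      obtain ⟨u, hu, h2⟩ := step (-d) (neg_ne_zero.2 hd) (fun e he => by simp [hsupp e he])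
        (by rw [map_neg, hcirc, neg_zero])
      have h3 := (convex_convexHull ℝ (roundings ini fin f)) h1 h2
        (a := u / (t + u)) (b := t / (t + u)) (by positivity) (by positivity) (by field_simp; ring)
      convert h3 using 1
      funext e
      simp only [Pi.add_apply, Pi.smul_apply, Pi.neg_apply, smul_eq_mul]
      field_simp
      ring

end Netflow

/-! ### Conformal exchange -/

section Exchange

variable {W E ι : Type*} [DecidableEq W] [Fintype E] [Fintype ι]

/-- One can move from `u` to `v` along an edge in the direction of the flow `d`. -/
def FlowStep (ini fin : E → W) (d : E → ℝ) (u v : W) : Prop :=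
  ∃ e, (ini e = u ∧ fin e = v ∧ 0 < d e) ∨ (fin e = u ∧ ini e = v ∧ d e < 0)

/-- Each step adds one unit on its edge with the sign of `d`. Repeated visits never cancel, since
all contributions to an edge have the same sign. -/
theorem exists_conformal_walk {ini fin : E → W} {d : E → ℝ} {u v : W}
    (h : Relation.ReflTransGen (FlowStep ini fin d) u v) :
    ∃ p : E → ℝ, (∀ e, p e ≠ 0 → 0 < d e * p e) ∧ ∀ x, netflow ini fin p x =
      (if u = x then 1 else 0) - (if v = x then 1 else 0) := by
  classical
  induction h with
  | refl => exact ⟨0, by simp, fun x => by simp⟩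
  | @tail v w _ hstep ih =>
    obtain ⟨p, hp, hnet⟩ := ih
    obtain ⟨e₀, he₀⟩ := hstep
    have hsingle : ∀ (c : ℝ) (x : W), netflow ini fin (Pi.single e₀ c) x =
        (if ini e₀ = x then c else 0) - (if fin e₀ = x then c else 0) := by
      intro c x
      rw [netflow_apply, Finset.sum_eq_single e₀]
      · simp
      · intro e _ he
        simp [he]
      · simp
    obtain ⟨c, hc, hcn⟩ : ∃ c : ℝ, 0 < d e₀ * c ∧ ∀ x, netflow ini fin (Pi.single e₀ c) x =
        (if v = x then 1 else 0) - (if w = x then 1 else 0) := by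
      rcases he₀ with ⟨h1, h2, h3⟩ | ⟨h1, h2, h3⟩
      · exact ⟨1, by linarith, fun x => by rw [hsingle, h1, h2]⟩
      · refine ⟨-1, by linarith, fun x => ?_⟩
        rw [hsingle, h1, h2]
        split_ifs <;> norm_num
    refine ⟨p + Pi.single e₀ c, fun e he => ?_, fun x => ?_⟩
    · by_cases hee : e = e₀
      · subst hee
        rw [Pi.add_apply, Pi.single_eq_same, mul_add]
        by_cases h0 : p e = 0
        · rw [h0, mul_zero, zero_add]; exact hc
        · exact add_pos (hp e h0) hc
      · rw [Pi.add_apply, Pi.single_eq_of_ne hee, add_zero] at he ⊢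
        exact hp e he
    · rw [map_add, Pi.add_apply, hnet, hcn]
      ring

/-- If `d` is a flow with boundary `x` whose value on the set `I` is negative, then a flow
conformal to `d` leads from a vertex in `I` to a vertex not in `I`. -/
theorem exists_conformal_exchange [Fintype W] {ini fin : E → W} (J : ι → W) {x : ι → ℝ} {d : E → ℝ}
    (hd : ∀ v, (∑ j, if J j = v then x j else 0) + netflow ini fin d v = 0)
    {I : Finset ι} (hI : ∑ j ∈ I, x j < 0) :
    ∃ i ∈ I, ∃ j, j ∉ I ∧ x i < 0 ∧ 0 < x j ∧ ∃ p : E → ℝ, (∀ e, p e ≠ 0 → 0 < d e * p e) ∧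
      ∀ v, netflow ini fin p v = (if J i = v then 1 else 0) - (if J j = v then 1 else 0) := by
  classical
  -- The set `R` is closed under steps of `d`, so its net outflow is at most zero and the sum of `x
  -- j` over `J j ∈ R` is at least zero. Without a positive `x j` outside `I` that is reached, this
  -- sum would be at most the negative sum over `I`.
  let R : Finset W := Finset.univ.filter fun v =>
    ∃ i ∈ I, x i < 0 ∧ Relation.ReflTransGen (FlowStep ini fin d) (J i) v
  have hR : ∀ v, v ∈ R ↔ ∃ i ∈ I, x i < 0 ∧ Relation.ReflTransGen (FlowStep ini fin d) (J i) v :=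
    fun v => by simp [R]
  have hclosed : ∀ u v, u ∈ R → FlowStep ini fin d u v → v ∈ R := by
    intro u v hu huv
    obtain ⟨i, hi, hxi, hr⟩ := (hR u).1 hu
    exact (hR v).2 ⟨i, hi, hxi, hr.tail huv⟩
  by_contra hcon
  have hno : ∀ j, j ∉ I → J j ∈ R → x j ≤ 0 := by
    intro j hj hjR
    by_contra hx
    obtain ⟨i, hi, hxi, hr⟩ := (hR _).1 hjR
    exact hcon ⟨i, hi, j, hj, hxi, not_le.1 hx, exists_conformal_walk hr⟩
  have h1 : ∑ v ∈ R, netflow ini fin d v ≤ 0 := by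
    simp only [netflow_apply]
    rw [Finset.sum_comm]
    refine Finset.sum_nonpos fun e _ => ?_
    rw [Finset.sum_sub_distrib, Finset.sum_ite_eq, Finset.sum_ite_eq]
    by_cases h2 : ini e ∈ R
    · by_cases h3 : fin e ∈ R
      · simp [h2, h3]
      · rw [if_pos h2, if_neg h3, sub_zero]
        by_contra h4
        exact h3 (hclosed _ _ h2 ⟨e, Or.inl ⟨rfl, rfl, not_le.1 h4⟩⟩)
    · by_cases h3 : fin e ∈ R
      · rw [if_neg h2, if_pos h3, zero_sub]
        by_contra h4
        exact h2 (hclosed _ _ h3 ⟨e, Or.inr ⟨rfl, rfl, by linarith⟩⟩)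
      · simp [h2, h3]
  have h2 : ∑ v ∈ R, ((∑ j, if J j = v then x j else 0) + netflow ini fin d v) = 0 :=
    Finset.sum_eq_zero fun v _ => hd v
  rw [Finset.sum_add_distrib, Finset.sum_comm] at h2
  simp only [Finset.sum_ite_eq] at h2
  have h3 : ∑ j, (if J j ∈ R then x j else 0) ≤ ∑ j, if j ∈ I then x j else 0 := by
    refine Finset.sum_le_sum fun j _ => ?_
    by_cases h4 : J j ∈ R
    · by_cases h5 : j ∈ I
      · simp [h4, h5]
      · simpa [h4, h5] using hno j h5 h4
    · by_cases h5 : j ∈ I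
      · rw [if_neg h4, if_pos h5]
        by_contra h6
        exact h4 ((hR _).2 ⟨j, h5, not_le.1 h6, .refl⟩)
      · simp [h4, h5]
  rw [Finset.sum_ite_mem, Finset.univ_inter] at h3
  linarith

/-- On each edge `q` points from `g` towards `f`, so a small multiple stays between them. Bounds
satisfied by both `f` and `g` are thereby preserved. -/
theorem exists_conformal_scale {g f q : E → ℝ} (hq : ∀ e, q e ≠ 0 → 0 < (f e - g e) * q e) :
    ∃ ε : ℝ, 0 < ε ∧ ∀ e, min (g e) (f e) ≤ g e + ε * q e ∧ g e + ε * q e ≤ max (g e) (f e) := by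
  classical
  have hone : ∀ e, ∃ ε : ℝ, 0 < ε ∧ ∀ δ, 0 < δ → δ ≤ ε →
      min (g e) (f e) ≤ g e + δ * q e ∧ g e + δ * q e ≤ max (g e) (f e) := by
    intro e
    by_cases h0 : q e = 0
    · exact ⟨1, one_pos, fun δ _ _ => by simp [h0]⟩
    · have h1 := hq e h0
      refine ⟨(f e - g e) / q e, ?_, fun δ hδ hle => ?_⟩
      · rwa [← mul_pos_iff_of_pos_right (mul_self_pos.2 h0), ← mul_assoc, div_mul_cancel₀ _ h0]
      · rcases lt_or_gt_of_ne h0 with h | h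
        · rw [le_div_iff_of_neg h] at hle
          have := mul_neg_of_pos_of_neg hδ h
          exact ⟨min_le_of_right_le (by linarith), le_max_of_le_left (by linarith)⟩
        · rw [le_div_iff₀ h] at hle
          have := mul_pos hδ h
          exact ⟨min_le_of_left_le (by linarith), le_max_of_le_right (by linarith)⟩
  choose ε hε hε' using hone
  rcases isEmpty_or_nonempty E with hE | hE
  · exact ⟨1, one_pos, fun e => hE.elim e⟩
  · obtain ⟨e₀, -, hmin⟩ := Finset.exists_min_image Finset.univ ε Finset.univ_nonempty
    exact ⟨ε e₀, hε e₀, fun e => hε' e _ (hε e₀) (hmin e (Finset.mem_univ e))⟩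

end Exchange

/-! ### Greedy minimizers and generalized permutahedra -/

section Permutahedron

/-- Layer-cake summation: `w` is a nonnegative combination of indicators of its superlevel sets. The
induction peels off the smallest positive value `m`. -/
theorem sum_mul_nonneg_of_superlevel_pos {ι : Type*} [Fintype ι] (x w : ι → ℝ)
    (hw : ∀ i, 0 ≤ w i) (hx : ∀ c, 0 < c → 0 ≤ ∑ i with c ≤ w i, x i) : 0 ≤ ∑ i, w i * x i := by
  classical
  induction hN : (Finset.univ.filter fun i => 0 < w i).card using Nat.strong_induction_on
    generalizing w with
  | _ N ih =>
    rcases (Finset.univ.filter fun i => 0 < w i).eq_empty_or_nonempty with hU | hU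
    · refine le_of_eq (Finset.sum_eq_zero fun i _ => ?_).symm
      have : ¬ 0 < w i := fun h => by
        have : i ∈ Finset.univ.filter fun i => 0 < w i := by simpa using h
        simp [hU] at this
      rw [le_antisymm (not_lt.1 this) (hw i), zero_mul]
    · obtain ⟨i₀, hi₀, hmin⟩ := Finset.exists_min_image _ w hU
      simp only [Finset.mem_filter, Finset.mem_univ, true_and] at hi₀ hmin
      set m := w i₀
      have hdec : ∀ i, w i = max (w i - m) 0 + (if m ≤ w i then m else 0) := by
        intro i
        split_ifs with h
        · rw [max_eq_left (by linarith)]; ring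
        · have h0 : ¬ 0 < w i := fun h0 => h (hmin i h0)
          have h1 := le_antisymm (not_lt.1 h0) (hw i)
          rw [max_eq_right (by linarith), h1, add_zero]
      have hlt : (Finset.univ.filter fun i => 0 < max (w i - m) 0).card < N := by
        rw [← hN]
        refine Finset.card_lt_card ⟨fun i hi => ?_, fun h => ?_⟩
        · simp only [Finset.mem_filter, Finset.mem_univ, true_and, lt_max_iff, lt_irrefl,
            or_false] at hi ⊢
          linarith
        · have := h (x := i₀) (by simpa using hi₀)
          simp [m] at this
      have h1 := ih _ hlt (fun i => max (w i - m) 0) (fun i => le_max_right _ _) (by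
        intro c hc
        have h2 := hx (c + m) (by linarith)
        have h3 : ∀ i, c ≤ max (w i - m) 0 ↔ c + m ≤ w i := by
          intro i
          rw [le_max_iff]
          constructor
          · rintro (h | h) <;> linarith
          · intro h; left; linarith
        simpa only [h3] using h2) rfl
      have h2 : ∑ i, w i * x i =
          ∑ i, max (w i - m) 0 * x i + m * ∑ i with m ≤ w i, x i := by
        rw [Finset.sum_filter, Finset.mul_sum, ← Finset.sum_add_distrib]
        refine Finset.sum_congr rfl fun i _ => ?_
        conv_lhs => rw [hdec i]
        split_ifs <;> ring
      rw [h2]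
      exact add_nonneg h1 (mul_nonneg hi₀.le (hx m hi₀))

/-- Adding a constant to `w` makes it nonnegative and, the total of `x` being zero, leaves the
weighted sum unchanged. -/
theorem sum_mul_nonneg_of_superlevel {ι : Type*} [Fintype ι] (x w : ι → ℝ)
    (hx : ∀ c, 0 ≤ ∑ i with c ≤ w i, x i) (hx0 : ∑ i, x i = 0) : 0 ≤ ∑ i, w i * x i := by
  classical
  obtain ⟨M, hM⟩ : ∃ M : ℝ, ∀ i, 0 ≤ w i + M := by
    refine ⟨∑ i, |w i|, fun i => ?_⟩
    have h1 := Finset.single_le_sum (f := fun i => |w i|) (fun i _ => abs_nonneg _)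
      (Finset.mem_univ i)
    have h2 := neg_abs_le (w i)
    linarith
  have h := sum_mul_nonneg_of_superlevel_pos x (fun i => w i + M) hM (fun c _ => by
    have h3 : ∀ i, c ≤ w i + M ↔ c - M ≤ w i := fun i => by
      constructor <;> intro h <;> linarith
    simpa only [h3] using hx (c - M))
  simpa only [add_mul, Finset.sum_add_distrib, ← Finset.mul_sum, hx0, mul_zero, add_zero] using h

/-- Every linear functional `w` has a minimizer on `S` that also minimizes the coordinate sums over
the superlevel sets of `w`. -/
def HasGreedyMinimizers {ι : Type*} [Fintype ι] (S : Set (ι → ℝ)) : Prop :=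
  ∀ w : ι → ℝ, ∃ g ∈ S, ∀ t ∈ S, ∀ c : ℝ,
    ∑ i with c ≤ w i, g i ≤ ∑ i with c ≤ w i, t i

variable {n : ℕ} {S : Set (Fin n → ℝ)}

theorem HasGreedyMinimizers.isLeast (hS : HasGreedyMinimizers S) (I : Finset (Fin n)) :
    IsLeast ((fun t => ∑ i ∈ I, t i) '' S) (sInf ((fun t => ∑ i ∈ I, t i) '' S)) := by
  classical
  obtain ⟨g, hg, hmin⟩ := hS (fun i => if i ∈ I then 1 else 0)
  have hI : (Finset.univ.filter fun i => (1 : ℝ) ≤ if i ∈ I then 1 else 0) = I := by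
    ext i
    by_cases h : i ∈ I <;> simp [h]
  have h : IsLeast ((fun t => ∑ i ∈ I, t i) '' S) (∑ i ∈ I, g i) := by
    refine ⟨⟨g, hg, rfl⟩, ?_⟩
    rintro _ ⟨t, ht, rfl⟩
    have := hmin t ht 1
    rwa [hI] at this
  rw [h.csInf_eq]
  exact h

/-- For the sum of the indicators of `I` and `J`, the superlevel sets at `1` and `2` are `I ∪ J` and
`I ∩ J`. One `g` attains both minima, and its sums over `I` and `J` bound the other two minima from
above. -/
theorem HasGreedyMinimizers.isSupermodular (hS : HasGreedyMinimizers S) :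
    IsSupermodular (fun I : Finset (Fin n) => sInf ((fun t => ∑ i ∈ I, t i) '' S)) := by
  classical
  constructor
  · obtain ⟨t, _, h⟩ := (hS.isLeast ∅).1
    rw [← h]
    simp
  · intro I J
    obtain ⟨g, hg, hmin⟩ := hS (fun i => (if i ∈ I then 1 else 0) + if i ∈ J then 1 else 0)
    have hU : (Finset.univ.filter fun i =>
        (1 : ℝ) ≤ (if i ∈ I then 1 else 0) + if i ∈ J then 1 else 0) = I ∪ J := by
      ext i
      by_cases h : i ∈ I <;> by_cases h' : i ∈ J <;> simp [h, h']
    have hN : (Finset.univ.filter fun i =>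
        (2 : ℝ) ≤ (if i ∈ I then 1 else 0) + if i ∈ J then 1 else 0) = I ∩ J := by
      ext i
      by_cases h : i ∈ I <;> by_cases h' : i ∈ J <;> (simp [h, h']; try norm_num)
    have key : ∀ K : Finset (Fin n), (∀ t ∈ S, ∑ i ∈ K, g i ≤ ∑ i ∈ K, t i) →
        ∑ i ∈ K, g i ≤ sInf ((fun t => ∑ i ∈ K, t i) '' S) := by
      intro K hK
      obtain ⟨t, ht, h⟩ := (hS.isLeast K).1
      rw [← h]
      exact hK t ht
    have h1 := key (I ∪ J) fun t ht => by
      have := hmin t ht 1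
      rwa [hU] at this
    have h2 := key (I ∩ J) fun t ht => by
      have := hmin t ht 2
      rwa [hN] at this
    have h3 := (hS.isLeast I).2 ⟨g, hg, rfl⟩
    have h4 := (hS.isLeast J).2 ⟨g, hg, rfl⟩
    have h5 := Finset.sum_union_inter (s₁ := I) (s₂ := J) (f := g)
    simp only at h3 h4
    linarith

/-- A point `t` satisfying the inequalities but outside `S` would be separated from `S` by some `w`.
For the greedy minimizer `g` of `w`, all superlevel sums of `t - g` are nonnegative, so `w` is not
smaller at `t` than at `g`. -/
theorem HasGreedyMinimizers.eq_genPermutahedron (hS : HasGreedyMinimizers S) (hconv : Convex ℝ S)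
    (hclosed : IsClosed S) {K : ℝ} (hsum : ∀ t ∈ S, ∑ i, t i = K) :
    S = genPermutahedron (fun I : Finset (Fin n) => sInf ((fun t => ∑ i ∈ I, t i) '' S)) := by
  classical
  have hK : sInf ((fun t => ∑ i ∈ (Finset.univ : Finset (Fin n)), t i) '' S) = K := by
    obtain ⟨t, ht, h⟩ := (hS.isLeast Finset.univ).1
    rw [← h]
    exact hsum t ht
  refine Set.Subset.antisymm (fun t ht => ⟨fun I _ => (hS.isLeast I).2 ⟨t, ht, rfl⟩, ?_⟩) ?_
  · exact (hsum t ht).trans hK.symm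
  · rintro t ⟨ht1, ht2⟩
    by_contra hcon
    replace ht2 := ht2.trans hK
    obtain ⟨φ, u, h1, h2⟩ := geometric_hahn_banach_point_closed hconv hclosed hcon
    obtain ⟨w, hw⟩ : ∃ w : Fin n → ℝ, ∀ s, φ s = ∑ i, w i * s i := by
      refine ⟨fun i => φ (Pi.single i 1), fun s => ?_⟩
      conv_lhs => rw [← Finset.univ_sum_single s, map_sum]
      refine Finset.sum_congr rfl fun i _ => ?_
      rw [mul_comm, ← smul_eq_mul, ← map_smul]
      congr 1
      ext j
      by_cases h : j = i
      · subst h; simp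
      · simp [h]
    obtain ⟨g, hg, hmin⟩ := hS w
    have h3 : 0 ≤ ∑ i, w i * (t i - g i) := by
      refine sum_mul_nonneg_of_superlevel (fun i => t i - g i) w (fun c => ?_) ?_
      · rw [Finset.sum_sub_distrib, sub_nonneg]
        -- The full set is constrained by the equality of totals, not by an inequality.
        by_cases h : (Finset.univ.filter fun i => c ≤ w i) = Finset.univ
        · rw [h, ht2, hsum g hg]
        · refine le_trans ?_ (ht1 _ h)
          obtain ⟨s, hs, h⟩ := (hS.isLeast (Finset.univ.filter fun i => c ≤ w i)).1
          exact (hmin s hs c).trans_eq h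
      · rw [Finset.sum_sub_distrib, ht2, hsum g hg, sub_self]
    have h4 := h2 g hg
    rw [hw] at h1 h4
    simp only [mul_sub, Finset.sum_sub_distrib] at h3
    linarith

end Permutahedron

/-! ### Capacitated flow polytopes -/

section CapacitatedFlows

variable {V E κ : Type} [DecidableEq V] [Fintype E]

/-- The flows on a directed multigraph with capacity `1` on the edges `cap e`. -/
def cappedFlows (ini fin : E → V) (b : V → ℝ) (cap : κ → E) : Set (E → ℝ) :=
  {f | f ∈ flowPolytope ini fin b ∧ ∀ e, f (cap e) ≤ 1}

variable {ini fin : E → V} {b : V → ℝ} {cap : κ → E}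

theorem convex_cappedFlows : Convex ℝ (cappedFlows ini fin b cap) := by
  intro f hf g hg s t hs ht hst
  simp only [cappedFlows, Set.mem_ofPred_eq, mem_flowPolytope] at hf hg ⊢
  obtain ⟨⟨f1, f2⟩, f3⟩ := hf
  obtain ⟨⟨g1, g2⟩, g3⟩ := hg
  refine ⟨⟨fun e => ?_, ?_⟩, fun e => ?_⟩
  · exact add_nonneg (mul_nonneg hs (f1 e)) (mul_nonneg ht (g1 e))
  · rw [map_add, map_smul, map_smul, f2, g2, ← add_smul, hst, one_smul]
  · have h1 := mul_le_mul_of_nonneg_left (f3 e) hs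
    have h2 := mul_le_mul_of_nonneg_left (g3 e) ht
    simp only [Pi.add_apply, Pi.smul_apply, smul_eq_mul]
    linarith

/-- The bounds `0` and `1` are integers, so floors and ceilings respect them. -/
theorem roundings_subset_cappedFlows {f : E → ℝ} (hf : f ∈ cappedFlows ini fin b cap) :
    roundings ini fin f ⊆ {g ∈ cappedFlows ini fin b cap | ∀ e, ∃ m : ℤ, g e = m} := by
  rintro g ⟨h1, h2, h3⟩
  obtain ⟨hf1, hf2⟩ := hf
  rw [mem_flowPolytope] at hf1
  refine ⟨⟨mem_flowPolytope.2 ⟨fun e => ?_, h2.trans hf1.2⟩, fun e => ?_⟩, h1⟩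
  · exact le_trans (by exact_mod_cast Int.floor_nonneg.2 (hf1.1 e)) (h3 e).1
  · refine (h3 _).2.trans ?_
    have : ⌈f (cap e)⌉ ≤ 1 := Int.ceil_le.2 (by simpa using hf2 e)
    exact_mod_cast this

variable [Fintype V]

theorem cappedFlows_eq_convexHull (hne : ∀ e, ini e ≠ fin e) (hb : ∀ v, ∃ m : ℤ, b v = m) :
    cappedFlows ini fin b cap =
      convexHull ℝ {g ∈ cappedFlows ini fin b cap | ∀ e, ∃ m : ℤ, g e = m} := by
  refine Set.Subset.antisymm (fun f hf => ?_) (convexHull_min (fun g hg => hg.1) convex_cappedFlows)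
  refine convexHull_mono (roundings_subset_cappedFlows hf) (mem_convexHull_roundings hne ?_)
  rw [(mem_flowPolytope.1 hf.1).2]
  exact hb

/-- A point of the convex hull of the roundings shows that a rounding exists. Where `f` is integral,
floor and ceiling force agreement; this lifts integer points of projections to integral flows. -/
theorem exists_integral_cappedFlow (hne : ∀ e, ini e ≠ fin e) (hb : ∀ v, ∃ m : ℤ, b v = m)
    {f : E → ℝ} (hf : f ∈ cappedFlows ini fin b cap) :
    ∃ g ∈ cappedFlows ini fin b cap, (∀ e, ∃ m : ℤ, g e = m) ∧
      ∀ e, (∃ m : ℤ, f e = m) → g e = f e := by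
  have h : f ∈ convexHull ℝ (roundings ini fin f) := by
    refine mem_convexHull_roundings hne ?_
    rw [(mem_flowPolytope.1 hf.1).2]
    exact hb
  obtain ⟨g, hg⟩ := convexHull_nonempty_iff.1 ⟨f, h⟩
  obtain ⟨h1, h2⟩ := roundings_subset_cappedFlows hf hg
  refine ⟨g, h1, h2, ?_⟩
  rintro e ⟨m, hm⟩
  obtain ⟨-, -, h3⟩ := hg
  have h4 := h3 e
  rw [hm, Int.floor_intCast, Int.ceil_intCast] at h4
  rw [hm]
  exact le_antisymm h4.2 h4.1

end CapacitatedFlows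

/-! ### The flow polytopes of a graph and the left-degree sequences -/

namespace Graph

variable {n : ℕ} (G : Graph n)

theorem sum_indeg : ∑ j : Fin n, G.indeg j.succ = G.numEdges := by
  have h0 : G.indeg 0 = 0 := by
    rw [indeg, Multiset.countP_eq_zero]
    exact fun e he => Fin.ne_zero_of_lt (G.increasing e he)
  have h1 : ∀ s : Multiset (Fin (n + 1) × Fin (n + 1)),
      ∑ v, s.countP (fun e => e.2 = v) = Multiset.card s := by
    intro s
    induction s using Multiset.induction with
    | empty => simp
    | cons e s ih => simp [Multiset.countP_cons, Finset.sum_add_distrib, ih]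
  have h2 := h1 G.edges
  rw [Fin.sum_univ_succ] at h2
  change G.indeg 0 + ∑ j : Fin n, G.indeg j.succ = G.numEdges at h2
  omega

/-- The part of the netflow at a vertex of `{1, …, n}` coming from the edges `z e` and `y e`. -/
def innerOutflow (f : G.AuxEdge → ℝ) (j : Fin n) : ℝ :=
  ∑ e : G.InnerEdge, ((if e.ini = j then f (.inr (.inl e)) + f (.inr (.inr e)) else 0) -
    (if e.fin = j then f (.inr (.inl e)) else 0))

theorem netflow_aug_coe (f : G.AuxEdge → ℝ) (j : Fin n) :
    netflow G.augIni G.augFin f j = f (.inl j) + G.innerOutflow f j := by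
  rw [netflow_apply, Fintype.sum_sum_type, Fintype.sum_sum_type, innerOutflow,
    ← Finset.sum_add_distrib]
  congr 1
  · simp [augIni, augFin]
  · refine Finset.sum_congr rfl fun e _ => ?_
    simp only [augIni, augFin, WithTop.coe_inj, WithTop.top_ne_coe, if_false]
    split_ifs <;> ring

theorem netflow_aug_top (f : G.AuxEdge → ℝ) :
    netflow G.augIni G.augFin f ⊤ = -(∑ j, f (.inl j)) - ∑ e, f (.inr (.inr e)) := by
  rw [netflow_apply, Fintype.sum_sum_type, Fintype.sum_sum_type]
  simp [augIni, augFin]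
  ring

theorem netflow_level_coe (f : G.AuxEdge → ℝ) (j : Fin n) :
    netflow G.levelIni G.levelFin f (j.castSucc : Fin (n + 1)) =
      f (.inl j) + G.innerOutflow f j := by
  rw [netflow_apply, Fintype.sum_sum_type, Fintype.sum_sum_type, innerOutflow,
    ← Finset.sum_add_distrib]
  congr 1
  · simp [levelIni, levelFin]
  · refine Finset.sum_congr rfl fun e _ => ?_
    have h : Fin.last n ≠ j.castSucc := (Fin.castSucc_lt_last j).ne'
    simp only [levelIni, levelFin, WithTop.coe_inj, Fin.castSucc_inj, h, if_false]
    split_ifs <;> ring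

theorem netflow_level_last (f : G.AuxEdge → ℝ) :
    netflow G.levelIni G.levelFin f (Fin.last n : Fin (n + 1)) = -∑ e, f (.inr (.inr e)) := by
  have h : ∀ j : Fin n, j.castSucc ≠ Fin.last n := fun j => (Fin.castSucc_lt_last j).ne
  rw [netflow_apply, Fintype.sum_sum_type, Fintype.sum_sum_type]
  simp [levelIni, levelFin, h]

theorem netflow_level_top (f : G.AuxEdge → ℝ) :
    netflow G.levelIni G.levelFin f ⊤ = -∑ j, f (.inl j) := by
  rw [netflow_apply, Fintype.sum_sum_type, Fintype.sum_sum_type]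
  simp [levelIni, levelFin]

theorem sum_innerOutflow (f : G.AuxEdge → ℝ) :
    ∑ j, G.innerOutflow f j = ∑ e, f (.inr (.inr e)) := by
  simp only [innerOutflow]
  rw [Finset.sum_comm]
  refine Finset.sum_congr rfl fun e _ => ?_
  rw [Finset.sum_sub_distrib, Finset.sum_ite_eq, Finset.sum_ite_eq]
  simp

/-- The conservation conditions at the vertices `1, …, n`. -/
def IsConserved (f : G.AuxEdge → ℝ) : Prop :=
  ∀ j, f (.inl j) + G.innerOutflow f j = G.indeg j.succ

variable {G} in
theorem IsConserved.sum_eq {f : G.AuxEdge → ℝ} (hf : G.IsConserved f) :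
    ∑ j, f (.inl j) + ∑ e, f (.inr (.inr e)) = G.numEdges := by
  rw [← G.sum_innerOutflow, ← Finset.sum_add_distrib, ← G.sum_indeg, Nat.cast_sum]
  exact Finset.sum_congr rfl fun j _ => hf j

/-- The condition at the sink is redundant: it follows by summing the conditions at `1, …, n`. -/
theorem mem_augFlowPolytope {f : G.AuxEdge → ℝ} : f ∈ G.augFlowPolytope ↔
    (∀ e, 0 ≤ f e) ∧ G.IsConserved f ∧ ∀ e, f (.inr (.inr e)) ≤ 1 := by
  simp only [augFlowPolytope, Set.mem_ofPred_eq, mem_flowPolytope, and_assoc, yEdge]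
  refine and_congr_right fun _ => and_congr_left fun _ => ⟨fun h j => ?_, fun h => ?_⟩
  · rw [← netflow_aug_coe, h]
    rfl
  · funext v
    induction v using WithTop.recTopCoe with
    | top =>
      rw [netflow_aug_top]
      have := h.sum_eq
      simp only [augNetflow]
      linarith
    | coe j =>
      rw [netflow_aug_coe, h j]
      rfl

/-- Sending the edges `y e` to `n + 1` prescribes their total as `k`. Given conservation, this says
that the edges `a j` carry `#E(G) - k` in total. -/
theorem mem_levelFlowPolytope {f : G.AuxEdge → ℝ} {k : ℕ} : f ∈ G.levelFlowPolytope k ↔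
    f ∈ G.augFlowPolytope ∧ ∑ j, f (.inl j) + k = G.numEdges := by
  rw [mem_augFlowPolytope]
  simp only [levelFlowPolytope, Set.mem_ofPred_eq, mem_flowPolytope, and_assoc, yEdge]
  refine and_congr_right fun _ => ⟨fun ⟨h1, h2⟩ => ?_, fun ⟨h1, h2, h3⟩ => ⟨?_, h2⟩⟩
  · refine ⟨fun j => ?_, h2, ?_⟩
    · rw [← netflow_level_coe, h1]
      simp [levelNetflow]
    · have h3 := congrFun h1 ⊤
      rw [netflow_level_top] at h3
      simp only [levelNetflow] at h3
      linarith
  · have h4 := h1.sum_eq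
    funext v
    induction v using WithTop.recTopCoe with
    | top =>
      rw [netflow_level_top]
      simp only [levelNetflow]
      linarith
    | coe v =>
      induction v using Fin.lastCases with
      | last =>
        rw [netflow_level_last]
        simp only [levelNetflow, Fin.lastCases_last]
        linarith
      | cast j =>
        rw [netflow_level_coe, h1 j]
        simp [levelNetflow]

theorem augIni_ne_augFin (e : G.AuxEdge) : G.augIni e ≠ G.augFin e := by
  rcases e with j | e | e
  · exact WithTop.coe_ne_top
  · intro h
    have h1 : e.ini = e.fin := WithTop.coe_inj.1 h
    have h2 := G.increasing e.1 (Multiset.mem_filter.1 (Multiset.coe_mem (m := G.innerEdges))).1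
    have h3 := congrArg Fin.succ h1
    rw [InnerEdge.ini, InnerEdge.fin, Fin.succ_pred, Fin.succ_pred] at h3
    exact h2.ne h3
  · exact WithTop.coe_ne_top

theorem levelIni_ne_levelFin (e : G.AuxEdge) : G.levelIni e ≠ G.levelFin e := by
  rcases e with j | e | e
  · exact WithTop.coe_ne_top
  · intro h
    refine G.augIni_ne_augFin (.inr (.inl e)) ?_
    exact congrArg _ (Fin.castSucc_injective _ (WithTop.coe_inj.1 h))
  · intro h
    exact (Fin.castSucc_lt_last _).ne (WithTop.coe_inj.1 h)

theorem augNetflow_integral (v : WithTop (Fin n)) : ∃ m : ℤ, G.augNetflow v = m := by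
  induction v using WithTop.recTopCoe with
  | top => exact ⟨-G.numEdges, by simp [augNetflow]⟩
  | coe j => exact ⟨G.indeg j.succ, by simp [augNetflow]⟩

theorem levelNetflow_integral (k : ℕ) (v : WithTop (Fin (n + 1))) :
    ∃ m : ℤ, G.levelNetflow k v = m := by
  induction v using WithTop.recTopCoe with
  | top => exact ⟨k - G.numEdges, by simp [levelNetflow]⟩
  | coe v =>
    induction v using Fin.lastCases with
    | last => exact ⟨-k, by simp [levelNetflow]⟩
    | cast j => exact ⟨G.indeg j.succ, by simp [levelNetflow]⟩

theorem augFlowPolytope_eq : G.augFlowPolytope =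
    cappedFlows G.augIni G.augFin G.augNetflow G.yEdge := rfl

theorem levelFlowPolytope_eq (k : ℕ) : G.levelFlowPolytope k =
    cappedFlows G.levelIni G.levelFin (G.levelNetflow k) G.yEdge := rfl

/-- The left-degree sequences of the leaves are the integral flows. -/
theorem mem_LD_iff (α : Fin n → ℕ) : α ∈ G.LD ↔ ∃ z y : G.InnerEdge → ℕ, (∀ e, y e ≤ 1) ∧
    ∀ j, (α j : ℤ) + ∑ e : G.InnerEdge, ((if e.ini = j then (z e : ℤ) + y e else 0) -
      (if e.fin = j then (z e : ℤ) else 0)) = G.indeg j.succ := by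
  classical
  -- The edges at `0` carry no flow but still count towards the indegrees.
  let O := G.edges.filter fun e => ¬ e.1 ≠ 0
  let ed : G.InnerEdge ⊕ O.ToType → Fin (n + 1) × Fin (n + 1) := Sum.elim (fun e => e.1) fun e => e.1
  have hed : (Finset.univ : Finset (G.InnerEdge ⊕ O.ToType)).val.map ed = G.edges := by
    have h1 : (Finset.univ : Finset (G.InnerEdge ⊕ O.ToType)).val =
        (Finset.univ : Finset G.InnerEdge).val.disjSum (Finset.univ : Finset O.ToType).val := rfl
    rw [h1, Multiset.disjSum, Multiset.map_add, Multiset.map_map, Multiset.map_map]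
    change Multiset.map (fun e : G.InnerEdge => e.1) _ + Multiset.map (fun e : O.ToType => e.1) _ = _
    rw [Multiset.map_univ_coe, Multiset.map_univ_coe]
    exact Multiset.filter_add_not _ _
  have hO : ∀ e : O.ToType, e.1.1 = 0 := fun e => not_not.1 (Multiset.mem_filter.1
    (Multiset.coe_mem (m := O) (x := e))).2
  have hcount := (Classical.arbitrary (ReductionTree G)).count_leftDegreeSeqs Finset.univ ed hed α
  have hmem : α ∈ G.LD ↔ (integerFlows Finset.univ ed α).Nonempty := by
    rw [← Multiset.one_le_count_iff_mem, Nat.one_le_iff_ne_zero, ← Set.encard_ne_zero, ← hcount, LD,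
      ne_eq, ne_eq, Nat.cast_eq_zero]
  have hweight : ∀ (z y : G.InnerEdge ⊕ O.ToType → ℕ), (∀ e, z (.inr e) = 0 ∧ y (.inr e) = 0) →
      ∀ j : Fin n, ∑ e, edgeWeight (ed e) (z e) (y e) j.succ = G.indeg j.succ -
        ∑ e : G.InnerEdge, ((if e.ini = j then (z (.inl e) : ℤ) + y (.inl e) else 0) -
          (if e.fin = j then (z (.inl e) : ℤ) else 0)) := by
    intro z y hzy j
    have h1 := sum_edgeWeight_zero Finset.univ ed j.succ
    rw [hed] at h1
    change _ = (G.indeg j.succ : ℤ) at h1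
    rw [← h1, Fintype.sum_sum_type, Fintype.sum_sum_type]
    have h2 : ∀ e : O.ToType, edgeWeight (ed (.inr e)) (z (.inr e)) (y (.inr e)) j.succ =
        edgeWeight (ed (.inr e)) 0 0 j.succ := fun e => by rw [(hzy e).1, (hzy e).2]
    simp only [h2]
    rw [add_sub_right_comm, ← Finset.sum_sub_distrib]
    congr 1
    refine Finset.sum_congr rfl fun e _ => ?_
    have h3 : (ed (.inl e)).1 = j.succ ↔ e.ini = j := (Fin.pred_eq_iff_eq_succ _).symm
    have h4 : (ed (.inl e)).2 = j.succ ↔ e.fin = j := (Fin.pred_eq_iff_eq_succ _).symm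
    simp only [edgeWeight, h3, h4]
    split_ifs <;> push_cast <;> ring
  rw [hmem]
  constructor
  · rintro ⟨⟨z, y⟩, h1, h2, h3⟩
    refine ⟨fun e => z (.inl e), fun e => y (.inl e), fun e => h2 _, fun j => ?_⟩
    have h4 := h3 j
    rw [hweight z y (fun e => h1 _ (Or.inr (hO e)))] at h4
    linarith
  · rintro ⟨z, y, h2, h3⟩
    refine ⟨(Sum.elim z 0, Sum.elim y 0), ?_, ?_, fun j => ?_⟩
    · rintro (e | e) he
      · simp only [Finset.mem_univ, not_true_eq_false, false_or] at he
        exact absurd he e.fst_ne_zero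
      · exact ⟨rfl, rfl⟩
    · rintro (e | e)
      · exact h2 e
      · exact zero_le_one
    · rw [hweight _ _ (fun e => ⟨rfl, rfl⟩)]
      simp only [Sum.elim_inl]
      linarith [h3 j]

theorem mem_LD_iff_exists_flow (α : Fin n → ℕ) : α ∈ G.LD ↔ ∃ f ∈ G.augFlowPolytope,
    (∀ e, ∃ m : ℤ, f e = m) ∧ G.sinkProjection f = fun j => (α j : ℝ) := by
  rw [mem_LD_iff]
  constructor
  · rintro ⟨z, y, h1, h2⟩
    refine ⟨Sum.elim (fun j => (α j : ℝ)) (Sum.elim (fun e => (z e : ℝ)) fun e => (y e : ℝ)),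
      G.mem_augFlowPolytope.2 ⟨?_, fun j => ?_, fun e => ?_⟩, ?_, rfl⟩
    · rintro (j | e | e) <;> exact Nat.cast_nonneg _
    · have := h2 j
      simp only [innerOutflow, Sum.elim_inl, Sum.elim_inr]
      exact_mod_cast this
    · simpa using h1 e
    · rintro (j | e | e)
      exacts [⟨α j, by simp⟩, ⟨z e, by simp⟩, ⟨y e, by simp⟩]
  · rintro ⟨f, hf, hint, hα⟩
    obtain ⟨h0, h1, h2⟩ := G.mem_augFlowPolytope.1 hf
    have hnat : ∀ e, ∃ m : ℕ, f e = m := by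
      intro e
      obtain ⟨m, hm⟩ := hint e
      have h3 := h0 e
      rw [hm] at h3
      refine ⟨m.toNat, ?_⟩
      rw [hm]
      exact_mod_cast (Int.toNat_of_nonneg (by exact_mod_cast h3)).symm
    choose m hm using hnat
    refine ⟨fun e => m (.inr (.inl e)), fun e => m (.inr (.inr e)), fun e => ?_, fun j => ?_⟩
    · have := h2 e
      rw [hm] at this
      exact_mod_cast this
    · have h3 := h1 j
      have h4 : f (.inl j) = α j := congrFun hα j
      rw [h4] at h3
      simp only [innerOutflow, hm] at h3
      exact_mod_cast h3

/-- The real vectors with entries in `LD(G)`. -/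
def leftDegreePoints : Set (Fin n → ℝ) :=
  {x | ∃ α ∈ G.LD, x = fun j => (α j : ℝ)}

/-- The elements of `LD(G)` with coordinate sum `#E(G) - k`, as real vectors. -/
def levelPoints (k : ℕ) : Set (Fin n → ℝ) :=
  {x | ∃ α ∈ G.LD, ∑ j, α j + k = G.numEdges ∧ x = fun j => (α j : ℝ)}

theorem finite_levelPoints (k : ℕ) : (G.levelPoints k).Finite := by
  classical
  refine Set.Finite.subset ((G.LD.toFinset.finite_toSet).image fun α j => (α j : ℝ)) ?_
  rintro _ ⟨α, hα, -, rfl⟩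
  exact ⟨α, by simpa using hα, rfl⟩

/-- The projection to the values on the edges `a j`, as a linear map. -/
def sinkProjectionLinear : (G.AuxEdge → ℝ) →ₗ[ℝ] (Fin n → ℝ) :=
  LinearMap.funLeft ℝ ℝ G.aEdge

theorem sinkProjection_image_integral :
    G.sinkProjectionLinear '' {f ∈ G.augFlowPolytope | ∀ e, ∃ m : ℤ, f e = m} =
      G.leftDegreePoints := by
  ext x
  constructor
  · rintro ⟨f, ⟨hf, hint⟩, rfl⟩
    have h0 := (G.mem_augFlowPolytope.1 hf).1
    have hnat : ∀ j, ∃ m : ℕ, f (G.aEdge j) = m := by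
      intro j
      obtain ⟨m, hm⟩ := hint (G.aEdge j)
      have h3 := h0 (G.aEdge j)
      rw [hm] at h3
      refine ⟨m.toNat, ?_⟩
      rw [hm]
      exact_mod_cast (Int.toNat_of_nonneg (by exact_mod_cast h3)).symm
    choose α hα using hnat
    have h1 : G.sinkProjection f = fun j => (α j : ℝ) := funext hα
    exact ⟨α, (G.mem_LD_iff_exists_flow α).2 ⟨f, hf, hint, h1⟩, h1⟩
  · rintro ⟨α, hα, rfl⟩
    obtain ⟨f, hf, hint, h⟩ := (G.mem_LD_iff_exists_flow α).1 hα
    exact ⟨f, ⟨hf, hint⟩, h⟩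

theorem sinkProjection_image_integral_level (k : ℕ) :
    G.sinkProjectionLinear '' {f ∈ G.levelFlowPolytope k | ∀ e, ∃ m : ℤ, f e = m} =
      G.levelPoints k := by
  ext x
  constructor
  · rintro ⟨f, ⟨hf, hint⟩, rfl⟩
    obtain ⟨hf1, hf2⟩ := G.mem_levelFlowPolytope.1 hf
    obtain ⟨α, hα, h⟩ := G.sinkProjection_image_integral.subset ⟨f, ⟨hf1, hint⟩, rfl⟩
    refine ⟨α, hα, ?_, h⟩
    have h1 : ∀ j, f (.inl j) = α j := fun j => congrFun h j
    simp only [h1] at hf2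
    exact_mod_cast hf2
  · rintro ⟨α, hα, hsum, rfl⟩
    obtain ⟨f, hf, hint, h⟩ := (G.mem_LD_iff_exists_flow α).1 hα
    refine ⟨f, ⟨G.mem_levelFlowPolytope.2 ⟨hf, ?_⟩, hint⟩, h⟩
    have h1 : ∀ j, f (.inl j) = α j := fun j => congrFun h j
    simp only [h1]
    exact_mod_cast hsum

theorem sinkProjection_image_aug :
    G.sinkProjection '' G.augFlowPolytope = convexHull ℝ G.leftDegreePoints := by
  rw [← G.sinkProjection_image_integral, ← LinearMap.image_convexHull, augFlowPolytope_eq,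
    ← cappedFlows_eq_convexHull G.augIni_ne_augFin G.augNetflow_integral]
  rfl

theorem sinkProjection_image_level (k : ℕ) :
    G.sinkProjection '' G.levelFlowPolytope k = convexHull ℝ (G.levelPoints k) := by
  rw [← G.sinkProjection_image_integral_level, ← LinearMap.image_convexHull, levelFlowPolytope_eq,
    ← cappedFlows_eq_convexHull G.levelIni_ne_levelFin (G.levelNetflow_integral k)]
  rfl

/-- A flow over an integer point is integral on the edges `a j`, so an integral rounding has the
same projection. -/
theorem integer_mem_image_aug_iff (p : Fin n → ℤ) :
    (fun j => (p j : ℝ)) ∈ G.sinkProjection '' G.augFlowPolytope ↔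
      ∃ α ∈ G.LD, ∀ j, (α j : ℤ) = p j := by
  constructor
  · rintro ⟨f, hf, hp⟩
    obtain ⟨g, hg, hint, hgf⟩ :=
      exists_integral_cappedFlow G.augIni_ne_augFin G.augNetflow_integral
        (G.augFlowPolytope_eq ▸ hf)
    obtain ⟨α, hα, h⟩ := G.sinkProjection_image_integral.subset ⟨g, ⟨hg, hint⟩, rfl⟩
    refine ⟨α, hα, fun j => ?_⟩
    have h1 : f (G.aEdge j) = p j := congrFun hp j
    have h2 : g (G.aEdge j) = α j := congrFun h j
    rw [hgf _ ⟨_, h1⟩, h1] at h2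
    exact_mod_cast h2.symm
  · rintro ⟨α, hα, h⟩
    rw [sinkProjection_image_aug]
    refine subset_convexHull ℝ _ ⟨α, hα, funext fun j => ?_⟩
    rw [← h j, Int.cast_natCast]

theorem sum_of_mem_image_level {k : ℕ} {t : Fin n → ℝ}
    (ht : t ∈ G.sinkProjection '' G.levelFlowPolytope k) : ∑ j, t j = G.numEdges - k := by
  obtain ⟨f, hf, rfl⟩ := ht
  have h := (G.mem_levelFlowPolytope.1 hf).2
  exact eq_sub_of_add_eq h

theorem integer_mem_image_level_iff (k : ℕ) (p : Fin n → ℤ) :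
    (fun j => (p j : ℝ)) ∈ G.sinkProjection '' G.levelFlowPolytope k ↔
      (∃ α ∈ G.LD, ∀ j, (α j : ℤ) = p j) ∧ ∑ j, p j = (G.numEdges : ℤ) - k := by
  constructor
  · intro hp
    refine ⟨(G.integer_mem_image_aug_iff p).1 ?_, ?_⟩
    · obtain ⟨f, hf, h⟩ := hp
      exact ⟨f, (G.mem_levelFlowPolytope.1 hf).1, h⟩
    · exact_mod_cast G.sum_of_mem_image_level hp
  · rintro ⟨⟨α, hα, h⟩, hsum⟩
    rw [sinkProjection_image_level]
    refine subset_convexHull ℝ _ ⟨α, hα, ?_, funext fun j => ?_⟩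
    · simp only [← h] at hsum
      zify
      linarith
    · rw [← h j, Int.cast_natCast]

/-! ### Exchange on the level polytopes -/

/-! The edges `z e` and `y e` of the graph `G^(k)`. -/

/-- Initial vertices of the edges `z e` and `y e`. -/
def tailIni : G.InnerEdge ⊕ G.InnerEdge → Fin (n + 1) :=
  Sum.elim (fun e => e.ini.castSucc) fun e => e.ini.castSucc

/-- Final vertices of the edges `z e` and `y e` in the graph `G^(k)`. -/
def tailFin : G.InnerEdge ⊕ G.InnerEdge → Fin (n + 1) :=
  Sum.elim (fun e => e.fin.castSucc) fun _ => Fin.last n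

theorem netflow_level_eq_tail (f : G.AuxEdge → ℝ) (v : Fin (n + 1)) :
    netflow G.levelIni G.levelFin f v =
      (∑ j : Fin n, if j.castSucc = v then f (.inl j) else 0) +
        netflow G.tailIni G.tailFin (fun e => f (.inr e)) v := by
  rw [netflow_apply, Fintype.sum_sum_type, netflow_apply]
  congr 1
  · simp only [levelIni, levelFin, WithTop.coe_inj, WithTop.top_ne_coe, if_false, sub_zero]
  · refine Finset.sum_congr rfl fun e _ => ?_
    rcases e with e | e <;>
      exact congrArg₂ (· - ·) (if_congr WithTop.coe_inj rfl rfl) (if_congr WithTop.coe_inj rfl rfl)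

/-- On the edges `z e` and `y e`, `f - g` is a flow whose boundary is given by the differences on
the edges `a l`. A conformal path from `i` to `j` shifts sink flow of `g` from `i` to `j`, and a
small multiple of it keeps the flow between `f` and `g`, hence admissible. -/
theorem exists_level_exchange {k : ℕ} {f g : G.AuxEdge → ℝ} (hf : f ∈ G.levelFlowPolytope k)
    (hg : g ∈ G.levelFlowPolytope k) {I : Finset (Fin n)}
    (hI : ∑ j ∈ I, f (.inl j) < ∑ j ∈ I, g (.inl j)) :
    ∃ i ∈ I, ∃ j, j ∉ I ∧ ∃ ε : ℝ, 0 < ε ∧ ∃ h ∈ G.levelFlowPolytope k,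
      ∀ l, h (.inl l) = g (.inl l) +
        ε * ((if j = l then 1 else 0) - if i = l then 1 else 0) := by
  have hf' := mem_flowPolytope.1 hf.1
  have hg' := mem_flowPolytope.1 hg.1
  have hd : ∀ v : Fin (n + 1), (∑ j : Fin n, if j.castSucc = v then f (.inl j) - g (.inl j) else 0) +
      netflow G.tailIni G.tailFin (fun e => f (.inr e) - g (.inr e)) v = 0 := by
    intro v
    have h1 := G.netflow_level_eq_tail (f - g) v
    rw [map_sub, hf'.2, hg'.2, sub_self] at h1
    exact h1.symm
  obtain ⟨i, hi, j, hj, hxi, hxj, p, hp, hnet⟩ :=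
    exists_conformal_exchange Fin.castSucc hd (I := I)
      (by rw [Finset.sum_sub_distrib]; linarith)
  have hij : i ≠ j := fun h => hj (h ▸ hi)
  let q : G.AuxEdge → ℝ := Sum.elim (fun l => (if j = l then 1 else 0) - if i = l then 1 else 0) p
  obtain ⟨ε, hε, hbox⟩ := exists_conformal_scale (g := g) (f := f) (q := q) (by
    rintro (l | e) he
    · simp only [q, Sum.elim_inl] at he ⊢
      by_cases h1 : j = l
      · subst h1
        rw [if_pos rfl, if_neg hij]
        linarith
      · by_cases h2 : i = l
        · subst h2
          rw [if_neg h1, if_pos rfl]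
          linarith
        · simp [h1, h2] at he
    · exact hp e he)
  have hq : netflow G.levelIni G.levelFin q = 0 := by
    funext v
    induction v using WithTop.recTopCoe with
    | top =>
      rw [netflow_level_top]
      simp [q]
    | coe v =>
      rw [netflow_level_eq_tail]
      have h1 : netflow G.tailIni G.tailFin (fun e => q (.inr e)) v = _ := hnet v
      rw [h1]
      have h2 : ∀ l : Fin n, (if l.castSucc = v then q (.inl l) else 0) =
          (if j = l then (if j.castSucc = v then (1 : ℝ) else 0) else 0) -
            (if i = l then (if i.castSucc = v then (1 : ℝ) else 0) else 0) := by
        intro l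
        simp only [q, Sum.elim_inl]
        by_cases h1 : j = l
        · subst h1
          simp [hij]
        · by_cases h2 : i = l
          · subst h2
            simp only [h1, if_true, if_false]
            split_ifs <;> norm_num
          · simp [h1, h2]
      simp only [h2, Finset.sum_sub_distrib, Finset.sum_ite_eq, Finset.mem_univ, if_true]
      simp
  refine ⟨i, hi, j, hj, ε, hε, g + ε • q, ⟨mem_flowPolytope.2 ⟨fun e => ?_, ?_⟩, fun e => ?_⟩,
    fun l => rfl⟩
  · exact (le_min (hg'.1 e) (hf'.1 e)).trans (hbox e).1
  · rw [map_add, map_smul, hq, smul_zero, add_zero, hg'.2]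
  · exact (hbox _).2.trans (max_le (hg.2 e) (hf.2 e))

/-- Any minimizer of `w` works for every `c`: if its sum over `{c ≤ w i}` were not minimal, an
exchange would move flow from some `i` with `c ≤ w i` to some `j` with `w j < c`, and so lower `w`.
-/
theorem hasGreedyMinimizers_level {k : ℕ} (hne : (G.levelPoints k).Nonempty) :
    HasGreedyMinimizers (G.sinkProjection '' G.levelFlowPolytope k) := by
  intro w
  obtain ⟨x, hx, hmin⟩ := Set.exists_min_image (G.levelPoints k) (fun t => ∑ j, w j * t j)
    (G.finite_levelPoints k) hne
  have hlin : ∀ t ∈ G.sinkProjection '' G.levelFlowPolytope k,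
      ∑ j, w j * x j ≤ ∑ j, w j * t j := by
    intro t ht
    rw [sinkProjection_image_level] at ht
    refine convexHull_min (s := G.levelPoints k) (t := {t | ∑ j, w j * x j ≤ ∑ j, w j * t j})
      hmin ?_ ht
    refine convex_halfSpace_ge (f := fun t : Fin n → ℝ => ∑ j, w j * t j) ⟨fun a b => ?_,
      fun c a => ?_⟩ _
    · simp [mul_add, Finset.sum_add_distrib]
    · simp only [Pi.smul_apply, smul_eq_mul, Finset.mul_sum]
      exact Finset.sum_congr rfl fun j _ => by ring
  have hxS : x ∈ G.sinkProjection '' G.levelFlowPolytope k := by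
    rw [sinkProjection_image_level]
    exact subset_convexHull ℝ _ hx
  refine ⟨x, hxS, ?_⟩
  obtain ⟨g, hg, rfl⟩ := hxS
  rintro _ ⟨f, hf, rfl⟩ c
  by_contra hcon
  obtain ⟨i, hi, j, hj, ε, hε, h, hh, hval⟩ :=
    G.exists_level_exchange hf hg (I := Finset.univ.filter fun i => c ≤ w i) (not_le.1 hcon)
  have h1 := hlin _ ⟨h, hh, rfl⟩
  have h2 : ∑ l, w l * G.sinkProjection h l =
      ∑ l, w l * G.sinkProjection g l + ε * (w j - w i) := by
    have h3 : ∀ l, w l * G.sinkProjection h l = w l * G.sinkProjection g l +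
        ε * ((if j = l then w l else 0) - if i = l then w l else 0) := by
      intro l
      rw [sinkProjection, aEdge, hval l]
      change w l * (g (.inl l) + _) = w l * g (.inl l) + _
      split_ifs <;> ring
    simp only [h3, Finset.sum_add_distrib, ← Finset.mul_sum, Finset.sum_sub_distrib,
      Finset.sum_ite_eq, Finset.mem_univ, if_true]
  rw [h2] at h1
  simp only [Finset.mem_filter, Finset.mem_univ, true_and, not_le] at hi hj
  have := mul_neg_of_pos_of_neg hε (by linarith : w j - w i < 0)
  linarith

theorem sinkFlowValues_eq (k : ℕ) (I : Finset (Fin n)) : G.sinkFlowValues k I =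
    (fun t => ∑ i ∈ I, t i) '' (G.sinkProjection '' G.levelFlowPolytope k) := by
  ext s
  constructor
  · rintro ⟨f, hf, rfl⟩
    exact ⟨_, ⟨f, hf, rfl⟩, rfl⟩
  · rintro ⟨_, ⟨f, hf, rfl⟩, rfl⟩
    exact ⟨f, hf, rfl⟩

theorem minSinkFlow_eq (k : ℕ) : G.minSinkFlow k = fun I : Finset (Fin n) =>
    sInf ((fun t => ∑ i ∈ I, t i) '' (G.sinkProjection '' G.levelFlowPolytope k)) := by
  funext I
  rw [minSinkFlow, sinkFlowValues_eq]

theorem level_genPermutahedron {k : ℕ} (hne : (G.levelPoints k).Nonempty) :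
    (∀ I : Finset (Fin n), IsLeast (G.sinkFlowValues k I) (G.minSinkFlow k I)) ∧
      IsSupermodular (G.minSinkFlow k) ∧
      G.sinkProjection '' G.levelFlowPolytope k = genPermutahedron (G.minSinkFlow k) := by
  have hS := G.hasGreedyMinimizers_level hne
  refine ⟨fun I => ?_, ?_, ?_⟩
  · rw [minSinkFlow_eq, sinkFlowValues_eq]
    exact hS.isLeast I
  · rw [minSinkFlow_eq]
    exact hS.isSupermodular
  · rw [minSinkFlow_eq]
    refine hS.eq_genPermutahedron ?_ ?_ fun t ht => G.sum_of_mem_image_level ht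
    · rw [sinkProjection_image_level]
      exact convex_convexHull ℝ _
    · rw [sinkProjection_image_level]
      exact (G.finite_levelPoints k).isClosed_convexHull ℝ

/-! ### Coefficients and Newton polytopes -/

/-- The sign depends only on the exponent, so equal exponents never cancel. -/
theorem coeff_sum_monomials (N : ℕ) (S : Multiset (Fin n → ℕ)) (m : Fin n →₀ ℕ) :
    ((S.map fun α => (-1) ^ (N - ∑ i, α i) *
      ∏ i, (MvPolynomial.X i : MvPolynomial (Fin n) ℤ) ^ α i).sum).coeff m =
      (-1) ^ (N - ∑ i, m i) * (S.count ⇑m : ℤ) := by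
  induction S using Multiset.induction with
  | empty => simp
  | cons α S ih =>
    have h1 : ((-1) ^ (N - ∑ i, α i) * ∏ i, (MvPolynomial.X i : MvPolynomial (Fin n) ℤ) ^ α i) =
        MvPolynomial.monomial (Finsupp.equivFunOnFinite.symm α) ((-1) ^ (N - ∑ i, α i)) := by
      rw [MvPolynomial.monomial_eq, Finsupp.prod_fintype _ _ (fun i => pow_zero _), map_pow,
        map_neg, map_one]
      rfl
    rw [Multiset.map_cons, Multiset.sum_cons, MvPolynomial.coeff_add, ih, h1,
      MvPolynomial.coeff_monomial, Multiset.count_cons]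
    by_cases h : α = ⇑m
    · subst h
      have h2 : Finsupp.equivFunOnFinite.symm ⇑m = m := Finsupp.equivFunOnFinite.symm_apply_apply m
      rw [if_pos h2, if_pos rfl]
      push_cast
      ring
    · have h2 : Finsupp.equivFunOnFinite.symm α ≠ m := by
        rintro rfl
        exact h rfl
      rw [if_neg h2, if_neg (Ne.symm h)]
      simp

theorem coeff_leftDegreePolynomial (m : Fin n →₀ ℕ) : G.leftDegreePolynomial.coeff m =
    (-1) ^ (G.numEdges - ∑ i, m i) * (G.LD.count ⇑m : ℤ) :=
  coeff_sum_monomials _ _ _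

theorem coeff_leftDegreePolynomial_ne_zero (m : Fin n →₀ ℕ) :
    G.leftDegreePolynomial.coeff m ≠ 0 ↔ ⇑m ∈ G.LD := by
  rw [coeff_leftDegreePolynomial, mul_ne_zero_iff, Nat.cast_ne_zero, Multiset.count_ne_zero]
  exact and_iff_right (pow_ne_zero _ (by norm_num))

theorem coeff_leftDegreeComponent (k : ℕ) (m : Fin n →₀ ℕ) :
    (G.leftDegreeComponent k).coeff m =
      if ∑ i, m i + k = G.numEdges then G.leftDegreePolynomial.coeff m else 0 := by
  rw [leftDegreeComponent]
  by_cases hk : k ≤ G.numEdges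
  · rw [if_pos hk, MvPolynomial.coeff_homogeneousComponent, Finsupp.degree_eq_sum]
    exact if_congr (by omega) rfl rfl
  · rw [if_neg hk, if_neg (by omega), MvPolynomial.coeff_zero]

theorem coeff_leftDegreeComponent_ne_zero (k : ℕ) (m : Fin n →₀ ℕ) :
    (G.leftDegreeComponent k).coeff m ≠ 0 ↔ ⇑m ∈ G.LD ∧ ∑ i, m i + k = G.numEdges := by
  rw [coeff_leftDegreeComponent, ← coeff_leftDegreePolynomial_ne_zero]
  split_ifs with h <;> simp [h]

theorem newton_leftDegreePolynomial :
    newton G.leftDegreePolynomial = G.sinkProjection '' G.augFlowPolytope := by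
  rw [sinkProjection_image_aug, newton]
  congr 1
  ext x
  constructor
  · rintro ⟨m, hm, rfl⟩
    exact ⟨m, (G.coeff_leftDegreePolynomial_ne_zero m).1 hm, rfl⟩
  · rintro ⟨α, hα, rfl⟩
    exact ⟨Finsupp.equivFunOnFinite.symm α, (G.coeff_leftDegreePolynomial_ne_zero _).2 hα, rfl⟩

theorem newton_leftDegreeComponent (k : ℕ) :
    newton (G.leftDegreeComponent k) = G.sinkProjection '' G.levelFlowPolytope k := by
  rw [sinkProjection_image_level, newton]
  congr 1
  ext x
  constructor
  · rintro ⟨m, hm, rfl⟩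
    obtain ⟨h1, h2⟩ := (G.coeff_leftDegreeComponent_ne_zero k m).1 hm
    exact ⟨m, h1, h2, rfl⟩
  · rintro ⟨α, hα, hsum, rfl⟩
    exact ⟨Finsupp.equivFunOnFinite.symm α,
      (G.coeff_leftDegreeComponent_ne_zero k _).2 ⟨hα, hsum⟩, rfl⟩

theorem hasPolytopalSupport_leftDegreePolynomial :
    HasPolytopalSupport G.leftDegreePolynomial := by
  intro p hp
  rw [newton_leftDegreePolynomial, integer_mem_image_aug_iff] at hp
  obtain ⟨α, hα, h⟩ := hp
  exact ⟨Finsupp.equivFunOnFinite.symm α, h, (G.coeff_leftDegreePolynomial_ne_zero _).2 hα⟩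

theorem hasPolytopalSupport_leftDegreeComponent (k : ℕ) :
    HasPolytopalSupport (G.leftDegreeComponent k) := by
  intro p hp
  rw [newton_leftDegreeComponent, integer_mem_image_level_iff] at hp
  obtain ⟨⟨α, hα, h⟩, hsum⟩ := hp
  refine ⟨Finsupp.equivFunOnFinite.symm α, h, (G.coeff_leftDegreeComponent_ne_zero k _).2 ⟨hα, ?_⟩⟩
  simp only [← h] at hsum
  simp only [Finsupp.equivFunOnFinite_symm_apply_apply]
  zify
  linarith

theorem levelPoints_nonempty {k : ℕ} (h : G.leftDegreeComponent k ≠ 0) :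
    (G.levelPoints k).Nonempty := by
  obtain ⟨m, hm⟩ := MvPolynomial.ne_zero_iff.1 h
  obtain ⟨h1, h2⟩ := (G.coeff_leftDegreeComponent_ne_zero k m).1 hm
  exact ⟨_, m, h1, h2, rfl⟩

/-! ### Forests, and independence of the reduction tree -/

variable {G}

/-- A circulation supported on the edges of a forest vanishes. -/
theorem circulation_eq_zero (hG : G.IsAcyclic) {d : Fin (n + 1) × Fin (n + 1) → ℝ}
    (hsupp : ∀ e, e ∉ G.edges → d e = 0) (hd : netflow Prod.fst Prod.snd d = 0) : d = 0 := by
  classical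
  funext e₀
  by_contra hne
  have he₀ : e₀ ∈ G.edges := by_contra fun h => hne (hsupp _ h)
  obtain ⟨u, v⟩ := e₀
  have huv : u < v := G.increasing _ he₀
  set H := SimpleGraph.fromRel (fun u v => (u, v) ∈ G.edges) with hH
  have hadj : ∀ e ∈ G.edges, H.Adj e.1 e.2 := fun e he =>
    (SimpleGraph.fromRel_adj _ _ _).2 ⟨(G.increasing e he).ne, Or.inl he⟩
  have hbridge := SimpleGraph.isAcyclic_iff_forall_isBridge.1 hG.2
    ((SimpleGraph.mem_edgeSet _).2 (hadj _ he₀))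
  rw [SimpleGraph.isBridge_iff] at hbridge
  set K := H.deleteEdges {s(u, v)} with hK
  -- Every edge of a forest is a bridge, so `(u, v)` is the only edge leaving the component `C` of
  -- `u` after its removal. The net outflow of `C` is therefore `d (u, v)`.
  let C : Finset (Fin (n + 1)) := Finset.univ.filter fun x => K.Reachable u x
  have hC : ∀ x, x ∈ C ↔ K.Reachable u x := fun x => by simp [C]
  have hother : ∀ e ∈ G.edges, e ≠ (u, v) → (e.1 ∈ C ↔ e.2 ∈ C) := by
    intro e he heuv
    have h1 : K.Adj e.1 e.2 := by
      rw [hK, SimpleGraph.deleteEdges_adj]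
      refine ⟨hadj e he, fun h => ?_⟩
      rw [Set.mem_singleton_iff, Sym2.eq_iff] at h
      rcases h with ⟨h2, h3⟩ | ⟨h2, h3⟩
      · exact heuv (Prod.ext h2 h3)
      · have := G.increasing e he
        rw [h2, h3] at this
        exact lt_asymm huv this
    rw [hC, hC]
    exact ⟨fun h => h.trans h1.reachable, fun h => h.trans h1.symm.reachable⟩
  have hsum : ∑ x ∈ C, netflow Prod.fst Prod.snd d x = 0 := by
    rw [hd]
    simp
  simp only [netflow_apply] at hsum
  rw [Finset.sum_comm, Finset.sum_eq_single (u, v)] at hsum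
  · rw [Finset.sum_sub_distrib, Finset.sum_ite_eq, Finset.sum_ite_eq,
      if_pos ((hC u).2 (SimpleGraph.Reachable.refl u)), if_neg (fun h => hbridge ((hC v).1 h)),
      sub_zero] at hsum
    exact hne hsum
  · intro e _ he
    rw [Finset.sum_sub_distrib, Finset.sum_ite_eq, Finset.sum_ite_eq]
    by_cases hmem : e ∈ G.edges
    · by_cases h : e.1 ∈ C
      · rw [if_pos h, if_pos ((hother e hmem he).1 h), sub_self]
      · rw [if_neg h, if_neg (fun h' => h ((hother e hmem he).2 h')), sub_self]
    · simp [hsupp e hmem]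
  · intro h
    exact absurd (Finset.mem_univ _) h

/-- The weights of an edge `e` sum to `1 - f.2 e`, so the total of `α` is `#E(G)` minus the total of
`f.2`. -/
theorem integerFlows_snd_eq_zero {ι : Type*} {s : Finset ι}
    {ed : ι → Fin (n + 1) × Fin (n + 1)} (hs : s.val.map ed = G.edges) {α : Fin n → ℕ}
    (hα : ∑ j, α j = G.numEdges) {f : (ι → ℕ) × (ι → ℕ)} (hf : f ∈ integerFlows s ed α) :
    f.2 = 0 := by
  obtain ⟨h1, -, h3⟩ := hf
  have hinc : ∀ e ∈ s, (ed e).2 ≠ 0 := fun e he =>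
    Fin.ne_zero_of_lt (G.increasing _ (hs ▸ Multiset.mem_map_of_mem ed he))
  have hone : ∀ e ∈ s, ∑ j : Fin n, edgeWeight (ed e) (f.1 e) (f.2 e) j.succ = 1 - f.2 e := by
    intro e he
    have h4 : ∑ x, edgeWeight (ed e) (f.1 e) (f.2 e) x = 1 - f.2 e := by
      simp only [edgeWeight, Finset.sum_sub_distrib, Finset.sum_ite_eq, Finset.mem_univ, if_true]
      ring
    rw [Fin.sum_univ_succ, edgeWeight, if_neg (hinc e he)] at h4
    by_cases h5 : (ed e).1 = 0
    · have h6 := h1 e (Or.inr h5)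
      simpa [h6.1, h6.2] using h4
    · simpa [h5] using h4
  have hsum : ((∑ j, α j : ℕ) : ℤ) = s.card - ∑ e ∈ s, (f.2 e : ℤ) := by
    push_cast
    simp only [h3]
    rw [Finset.sum_comm, Finset.sum_congr rfl hone, Finset.sum_sub_distrib]
    simp
  have hcard : s.card = G.numEdges := by
    rw [numEdges, ← hs, Multiset.card_map, Finset.card_val]
  rw [hα, hcard] at hsum
  have hzero : ∑ e ∈ s, f.2 e = 0 := by
    have : ((∑ e ∈ s, f.2 e : ℕ) : ℤ) = 0 := by push_cast; linarith
    exact_mod_cast this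
  funext e
  by_cases he : e ∈ s
  · exact Finset.sum_eq_zero_iff.1 hzero e he
  · exact (h1 e (Or.inl he)).2

/-- For a forest, a left-degree sequence with maximal coordinate sum occurs at most once. -/
theorem count_LD_le_one (hG : G.IsAcyclic) {α : Fin n → ℕ} (hα : ∑ j, α j = G.numEdges) :
    G.LD.count α ≤ 1 := by
  classical
  -- There are no parallel edges, so the edges can serve as their own labels.
  have hs : (G.edges.toFinset).val.map id = G.edges := by
    rw [Multiset.map_id, Multiset.toFinset_val, hG.1.dedup]
  have hcount := (Classical.arbitrary (ReductionTree G)).count_leftDegreeSeqs _ _ hs α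
  have hle : (integerFlows G.edges.toFinset id α).encard ≤ 1 := by
    refine Set.encard_le_one_iff.2 fun f g hf hg => ?_
    have hf2 := integerFlows_snd_eq_zero hs hα hf
    have hg2 := integerFlows_snd_eq_zero hs hα hg
    obtain ⟨f1, -, f3⟩ := hf
    obtain ⟨g1, -, g3⟩ := hg
    refine Prod.ext ?_ (hf2.trans hg2.symm)
    have hoff : ∀ e, e ∉ G.edges → f.1 e = 0 ∧ g.1 e = 0 := fun e he =>
      ⟨(f1 e (Or.inl (by simpa using he))).1, (g1 e (Or.inl (by simpa using he))).1⟩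
    -- Both flows have the same `α` and `y = 0`, so their difference is a circulation. At `0` no
    -- edge enters, and the edges going out carry nothing.
    have hd : (fun e => (f.1 e : ℝ) - g.1 e) = 0 := by
      refine circulation_eq_zero hG (fun e he => by simp [hoff e he]) (funext fun x => ?_)
      rw [netflow_apply, Pi.zero_apply]
      induction x using Fin.cases with
      | zero =>
        refine Finset.sum_eq_zero fun e _ => ?_
        by_cases he : e ∈ G.edges
        · rw [if_neg (Fin.ne_zero_of_lt (G.increasing e he)), sub_zero]
          split_ifs with h0
          · have hfe := f1 e (Or.inr h0)
            have hge := g1 e (Or.inr h0)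
            simp [hfe.1, hge.1]
          · rfl
        · simp [hoff e he]
      | succ j =>
        have h1 := (f3 j).symm.trans (g3 j)
        rw [← sub_eq_zero, ← Finset.sum_sub_distrib] at h1
        have h2 : ∑ e ∈ G.edges.toFinset, ((if e.1 = j.succ then (f.1 e : ℝ) - g.1 e else 0) -
            if e.2 = j.succ then (f.1 e : ℝ) - g.1 e else 0) =
            -((∑ e ∈ G.edges.toFinset, (edgeWeight (id e) (f.1 e) (f.2 e) j.succ -
              edgeWeight (id e) (g.1 e) (g.2 e) j.succ) : ℤ) : ℝ) := by
          rw [Int.cast_sum, ← Finset.sum_neg_distrib]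
          refine Finset.sum_congr rfl fun e _ => ?_
          simp only [edgeWeight, id, hf2, hg2, Pi.zero_apply]
          split_ifs <;> push_cast <;> ring
        rw [h1, Int.cast_zero, neg_zero] at h2
        refine Eq.trans (Finset.sum_subset (Finset.subset_univ _) fun e _ he => ?_).symm h2
        rw [Multiset.mem_toFinset] at he
        simp [hoff e he]
    funext e
    have := congrFun hd e
    simp only [Pi.zero_apply, sub_eq_zero] at this
    exact_mod_cast this
  rw [← hcount] at hle
  exact_mod_cast hle

/-- In top degree the sign is `(-1) ^ 0` and, for a forest, every multiplicity is one. -/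
theorem isIntegerPointTransform_of_isAcyclic (hG : G.IsAcyclic) :
    IsIntegerPointTransform (G.leftDegreeComponent 0) (newton (G.leftDegreeComponent 0)) := by
  refine ⟨fun p hp i => ?_, fun m => ⟨fun hm => ?_, fun hm => ?_⟩⟩
  · rw [newton_leftDegreeComponent, integer_mem_image_level_iff] at hp
    obtain ⟨⟨α, -, h⟩, -⟩ := hp
    rw [← h i]
    exact Int.natCast_nonneg _
  · have h1 : (fun i => (((m i : ℕ) : ℤ) : ℝ)) ∈ newton (G.leftDegreeComponent 0) := by
      simpa only [Int.cast_natCast] using hm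
    rw [newton_leftDegreeComponent,
      G.integer_mem_image_level_iff 0 (fun i => ((m i : ℕ) : ℤ))] at h1
    obtain ⟨⟨α, hα, h2⟩, h3⟩ := h1
    have h4 : α = ⇑m := funext fun i => Int.natCast_inj.1 (h2 i)
    subst h4
    have hsum : ∑ i, m i = G.numEdges := by
      rw [Nat.cast_zero, sub_zero] at h3
      exact_mod_cast h3
    have hcount : G.LD.count ⇑m = 1 :=
      le_antisymm (count_LD_le_one hG hsum) (Multiset.one_le_count_iff_mem.2 hα)
    rw [coeff_leftDegreeComponent, add_zero, if_pos hsum, coeff_leftDegreePolynomial, hsum, hcount]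
    simp
  · by_contra h
    exact hm (subset_convexHull ℝ _ ⟨m, h, rfl⟩)

variable (G) in
/-- The left-degree sequences do not depend on the reduction tree. -/
theorem leftDegreeSeqs_eq_LD (T : ReductionTree G) : T.leftDegreeSeqs = G.LD := by
  classical
  refine Multiset.ext.2 fun α => ?_
  have hed : (Finset.univ : Finset G.edges.ToType).val.map (fun e => e.1) = G.edges :=
    Multiset.map_univ_coe G.edges
  have h1 := T.count_leftDegreeSeqs Finset.univ _ hed α
  have h2 := (Classical.arbitrary (ReductionTree G)).count_leftDegreeSeqs Finset.univ _ hed α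
  exact_mod_cast h1.trans h2.symm

end Graph

end LeftDegree

end

theorem theoremB (n : ℕ) (G : LeftDegree.Graph n) :
    (∀ T : LeftDegree.ReductionTree G, T.leftDegreeSeqs = G.LD) ∧
    LeftDegree.newton G.leftDegreePolynomial = G.sinkProjection '' G.augFlowPolytope ∧
    (∀ p : Fin n → ℤ, (fun i => (p i : ℝ)) ∈ LeftDegree.newton G.leftDegreePolynomial ↔
      ∃ α ∈ G.LD, ∀ i, (α i : ℤ) = p i) ∧
    LeftDegree.HasPolytopalSupport G.leftDegreePolynomial ∧
    (∀ k : ℕ,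
      LeftDegree.newton (G.leftDegreeComponent k) =
        G.sinkProjection '' G.levelFlowPolytope k ∧
      (∀ p : Fin n → ℤ, (fun i => (p i : ℝ)) ∈ LeftDegree.newton (G.leftDegreeComponent k) ↔
        (∃ α ∈ G.LD, ∀ i, (α i : ℤ) = p i) ∧ ∑ i, p i = (G.numEdges : ℤ) - (k : ℤ)) ∧
      LeftDegree.HasPolytopalSupport (G.leftDegreeComponent k) ∧
      (G.leftDegreeComponent k ≠ 0 →
        (∀ I : Finset (Fin n), IsLeast (G.sinkFlowValues k I) (G.minSinkFlow k I)) ∧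
        LeftDegree.IsSupermodular (G.minSinkFlow k) ∧
        LeftDegree.newton (G.leftDegreeComponent k) =
          LeftDegree.genPermutahedron (G.minSinkFlow k))) ∧
    (G.IsAcyclic →
      LeftDegree.IsIntegerPointTransform (G.leftDegreeComponent 0)
        (LeftDegree.newton (G.leftDegreeComponent 0))) := by
  refine ⟨G.leftDegreeSeqs_eq_LD, G.newton_leftDegreePolynomial, fun p => ?_,
    G.hasPolytopalSupport_leftDegreePolynomial, fun k => ⟨G.newton_leftDegreeComponent k,
      fun p => ?_, G.hasPolytopalSupport_leftDegreeComponent k, fun h => ?_⟩,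
    LeftDegree.Graph.isIntegerPointTransform_of_isAcyclic⟩
  · rw [G.newton_leftDegreePolynomial]
    exact G.integer_mem_image_aug_iff p
  · rw [G.newton_leftDegreeComponent]
    exact G.integer_mem_image_level_iff k p
  · rw [G.newton_leftDegreeComponent]
    exact G.level_genPermutahedron (G.levelPoints_nonempty h)
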